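/- Let $S\subset\mathbb{R}^2$ be the unit circle, $Q_c,M_c>0$, $\boldsymbol e_1=(1,0)^{\mathrm T}$, $R(\boldsymbol n)=(2\boldsymbol n\otimes\boldsymbol n-\mathbb I)\boldsymbol e_1$ and $\mathcal G(\boldsymbol n)=(Q_cR(\boldsymbol n),M_c\boldsymbol n)\in\mathbb{R}^4$ for $\boldsymbol n\in S$, and let $\mathcal N=\mathcal G(S)$, so that $\mathcal G:S\to\mathcal N$ is a bijection. Let $\Omega\subset\mathbb{R}^2$ be an open, bounded, connected, Lipschitz set, let $\Psi^b\in H^{1/2}(\partial\Omega;\mathbb{R}^4)$ take values in $\mathcal N$ a.e. on $\partial\Omega$, and put $$W=\{\Phi\in H^1(\Omega;\mathbb{R}^4)\;:\;\Phi(x)\in\mathcal N\text{ for a.e. }x\in\Omega,\ \Phi|_{\partial\Omega}=\Psi^b\text{ (trace)}\},\qquad E(\Phi)=\frac12\int_\Omega\|\nabla\Phi\|^2\,dx,$$ where $\|\cdot\|$ is the Frobenius norm. Given $\Psi^j\in W$, the iteration performs the following four steps. 1. $\boldsymbol n^j=\mathcal G^{-1}\circ\Psi^j$. 2. $\boldsymbol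 w^j$ is the minimiser of $\frac12\int_\Omega\|\nabla(\boldsymbol n^j-\boldsymbol w)\|^2\,dx$ over $\boldsymbol K^j=\{\boldsymbol w\in H^1_0(\Omega;\mathbb{R}^2):\boldsymbol w(x)\cdot\boldsymbol n^j(x)=0\text{ for a.e. }x\in\Omega\}$. 3. $\boldsymbol n^{j+1}=P_S\circ(\boldsymbol n^j-\boldsymbol w^j)$, where $P_S(y)=y/\|y\|$ for $y\ne0$. 4. $\Psi^{j+1}=\mathcal G\circ\boldsymbol n^{j+1}$. Then for every initial field $\Psi^0\in W$ the iteration is well defined: for all $j\ge0$, $\boldsymbol n^j\in H^1(\Omega;\mathbb{R}^2)$ takes values in $S$ a.e., the minimiser $\boldsymbol w^j$ exists and is unique (as an element of $H^1_0(\Omega;\mathbb{R}^2)$), $\|\boldsymbol n^j-\boldsymbol w^j\|\ge1$ a.e. in $\Omega$, and $\Psi^{j+1}\in W$. The resulting sequence $(\Psi^j)_{j\ge0}$ in $W$ satisfies $$E(\Psi^{j+1})\le E(\Psi^j)\qquad\text{for all }j\ge0.$$ -/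

import Mathlib

open MeasureTheory Filter Topology
open scoped ContDiff ENNReal

noncomputable section

namespace Ferronematic

/-- Euclidean `m`-space `ℝᵐ`. -/
abbrev Eucl (m : ℕ) : Type := EuclideanSpace ℝ (Fin m)

/-! ### The circle, the map `𝒢` and the constraint manifold `𝒩` -/

/-- The unit circle `S` of `ℝ²`. -/
def circleS : Set (Eucl 2) := Metric.sphere 0 1

/-- The tangent space of `S` at `n`, that is `{v | v · n = 0}`. -/
def tangentS (n : Eucl 2) : Set (Eucl 2) := {v | inner ℝ v n = 0}

/-- `R(n) = (2 n ⊗ n - I) e₁`. -/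
def mapR (n : Eucl 2) : Eucl 2 :=
  WithLp.toLp 2
    (((2 : ℝ) • Matrix.vecMulVec (fun i => n i) (fun i => n i) - (1 : Matrix (Fin 2) (Fin 2) ℝ)).mulVec
      ![1, 0])

/-- `𝒢(n) = (Q_c R(n), M_c n)`; only its values on `S` matter. -/
def mapG (Qc Mc : ℝ) (n : Eucl 2) : Eucl 4 :=
  !₂[Qc * mapR n 0, Qc * mapR n 1, Mc * n 0, Mc * n 1]

/-- `𝒩 = 𝒢(S)`. -/
def manifoldN (Qc Mc : ℝ) : Set (Eucl 4) := mapG Qc Mc '' circleS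

/-- The inverse `𝒢⁻¹ : 𝒩 → S` of the bijection `𝒢 : S → 𝒩` (with an irrelevant constant value
outside `𝒩`). -/
def invG (Qc Mc : ℝ) : Eucl 4 → Eucl 2 := Function.invFunOn (mapG Qc Mc) circleS

/-- The projection `x ↦ x / ‖x‖` of `ℝ² ∖ {0}` onto `S`. -/
def projS (x : Eucl 2) : Eucl 2 := ‖x‖⁻¹ • x

/-! ### Lipschitz domains and Sobolev spaces

Elements of `H¹(Ω; ℝᵐ)` are represented by functions on `ℝ²`, of which only the values almost
everywhere in `Ω` matter. -/

/-- Open, bounded, connected sets `Ω ⊆ ℝ²` with Lipschitz boundary: near each boundary point, in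
suitable Cartesian coordinates, `Ω` is the region strictly above the graph of a Lipschitz
function. -/
structure IsLipschitzDomain (Ω : Set (Eucl 2)) : Prop where
  isOpen : IsOpen Ω
  isBounded : Bornology.IsBounded Ω
  isConnected : IsConnected Ω
  locally_epigraph : ∀ x ∈ frontier Ω, ∃ (T : Eucl 2 ≃ᵢ Eucl 2) (L : NNReal) (γ : ℝ → ℝ),
    LipschitzWith L γ ∧ ∀ᶠ y in 𝓝 x, (y ∈ Ω ↔ γ (T y 0) < T y 1)

/-- The function `g` is the weak `i`-th partial derivative of `u` in `Ω`. -/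
def IsWeakPartial {m : ℕ} (Ω : Set (Eucl 2)) (i : Fin 2) (u g : Eucl 2 → Eucl m) : Prop :=
  ∀ φ : Eucl 2 → ℝ, ContDiff ℝ ∞ φ → HasCompactSupport φ → tsupport φ ⊆ Ω →
    ∫ x in Ω, (fderiv ℝ φ x (EuclideanSpace.single i 1)) • u x = - ∫ x in Ω, φ x • g x

/-- `u` has a weak `i`-th partial derivative in `L²(Ω)`. -/
def HasL2WeakPartial {m : ℕ} (Ω : Set (Eucl 2)) (i : Fin 2) (u : Eucl 2 → Eucl m) : Prop :=
  ∃ g : Eucl 2 → Eucl m, MemLp g 2 (volume.restrict Ω) ∧ IsWeakPartial Ω i u g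

/-- `u ∈ H¹(Ω; ℝᵐ)`. -/
def MemH1 {m : ℕ} (Ω : Set (Eucl 2)) (u : Eucl 2 → Eucl m) : Prop :=
  MemLp u 2 (volume.restrict Ω) ∧ ∀ i, HasL2WeakPartial Ω i u

open Classical in
/-- The weak partial derivative `∂ᵢ u ∈ L²(Ω; ℝᵐ)` (unique almost everywhere in `Ω`), and `0` if
there is none. -/
def weakPartial {m : ℕ} (Ω : Set (Eucl 2)) (i : Fin 2) (u : Eucl 2 → Eucl m) : Eucl 2 → Eucl m :=
  if h : HasL2WeakPartial Ω i u then h.choose else 0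

/-- A norm of `H¹(Ω; ℝᵐ)` (equivalent to the Hilbertian one). -/
def h1Norm {m : ℕ} (Ω : Set (Eucl 2)) (u : Eucl 2 → Eucl m) : ℝ≥0∞ :=
  eLpNorm u 2 (volume.restrict Ω) + ∑ i, eLpNorm (weakPartial Ω i u) 2 (volume.restrict Ω)

/-- `u ∈ H¹₀(Ω; ℝᵐ)`, the closure in `H¹` of the smooth fields with compact support in `Ω`. -/
def MemH10 {m : ℕ} (Ω : Set (Eucl 2)) (u : Eucl 2 → Eucl m) : Prop :=
  MemH1 Ω u ∧ ∃ φ : ℕ → Eucl 2 → Eucl m,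
    (∀ k, ContDiff ℝ ∞ (φ k) ∧ HasCompactSupport (φ k) ∧ tsupport (φ k) ⊆ Ω) ∧
      Tendsto (fun k => h1Norm Ω (φ k - u)) atTop (𝓝 0)

/-- Arc length on `∂Ω`. -/
def boundaryMeasure (Ω : Set (Eucl 2)) : Measure (Eucl 2) :=
  (Measure.hausdorffMeasure 1).restrict (frontier Ω)

/-- `g ∈ H^{1/2}(∂Ω; ℝᵐ)`, by the Gagliardo-Slobodeckij seminorm on the one-dimensional set
`∂Ω`. -/
def MemHHalf {m : ℕ} (Ω : Set (Eucl 2)) (g : Eucl 2 → Eucl m) : Prop :=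
  MemLp g 2 (boundaryMeasure Ω) ∧
    ∫⁻ x, ∫⁻ y, ‖g x - g y‖ₑ ^ 2 / edist x y ^ 2 ∂(boundaryMeasure Ω) ∂(boundaryMeasure Ω) < ⊤

/-- `u ∈ H¹(Ω; ℝᵐ)` has the trace `g ∈ L²(∂Ω; ℝᵐ)`. The trace operator is the continuous extension
to `H¹(Ω)` of the restriction `φ ↦ φ|_∂Ω` of fields smooth up to the boundary, so its graph is the
closure of the graph of that restriction. -/
def HasTrace {m : ℕ} (Ω : Set (Eucl 2)) (u g : Eucl 2 → Eucl m) : Prop :=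
  MemH1 Ω u ∧ MemLp g 2 (boundaryMeasure Ω) ∧ ∃ φ : ℕ → Eucl 2 → Eucl m,
    (∀ k, ContDiff ℝ ∞ (φ k)) ∧
      Tendsto (fun k => h1Norm Ω (φ k - u)) atTop (𝓝 0) ∧
      Tendsto (fun k => eLpNorm (φ k - g) 2 (boundaryMeasure Ω)) atTop (𝓝 0)

/-- `½ ∫_Ω ‖∇u‖²` with the Frobenius norm of the gradient. -/
def energy {m : ℕ} (Ω : Set (Eucl 2)) (u : Eucl 2 → Eucl m) : ℝ :=
  (1 / 2) * ∫ x in Ω, ∑ i, ‖weakPartial Ω i u x‖ ^ 2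

/-! ### The admissible fields and the iteration -/

/-- The set `W` of `H¹` fields with values in `𝒩` almost everywhere in `Ω` and with trace `Ψb`. -/
def admissible (Qc Mc : ℝ) (Ω : Set (Eucl 2)) (Ψb : Eucl 2 → Eucl 4) : Set (Eucl 2 → Eucl 4) :=
  {Φ | MemH1 Ω Φ ∧ (∀ᵐ x ∂(volume.restrict Ω), Φ x ∈ manifoldN Qc Mc) ∧ HasTrace Ω Φ Ψb}

/-- The space `K` of the `H¹₀` fields that are tangent to `S` along `n`. -/
def tangentFields (Ω : Set (Eucl 2)) (n : Eucl 2 → Eucl 2) : Set (Eucl 2 → Eucl 2) :=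
  {w | MemH10 Ω w ∧ ∀ᵐ x ∂(volume.restrict Ω), w x ∈ tangentS (n x)}

/-- `w` minimises `½ ∫_Ω ‖∇(n - w)‖²` over the tangent fields along `n`. -/
def IsTangentMinimizer (Ω : Set (Eucl 2)) (n w : Eucl 2 → Eucl 2) : Prop :=
  w ∈ tangentFields Ω n ∧ IsMinOn (fun v => energy Ω (n - v)) (tangentFields Ω n) w

/-- `Ψ`, `n`, `w` are sequences generated by the iteration from the initial field `Ψ 0`. -/
structure IsIteration (Qc Mc : ℝ) (Ω : Set (Eucl 2)) (Ψ : ℕ → Eucl 2 → Eucl 4)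
    (n w : ℕ → Eucl 2 → Eucl 2) : Prop where
  pull_back : ∀ j, n j =ᵐ[volume.restrict Ω] fun x => invG Qc Mc (Ψ j x)
  minimise : ∀ j, IsTangentMinimizer Ω (n j) (w j)
  project : ∀ j, n (j + 1) =ᵐ[volume.restrict Ω] fun x => projS (n j x - w j x)
  push_forward : ∀ j, Ψ (j + 1) =ᵐ[volume.restrict Ω] fun x => mapG Qc Mc (n (j + 1) x)

end Ferronematic

end

/-!
The inverse of `𝒢` on `𝒩` is the restriction of a linear map (`lowerG`), and the projection to the
circle followed by `𝒢` agrees, off a disc of radius less than one, with a smooth map `liftG` on the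
plane with bounded derivative. Both maps act on `H¹` by the chain rule (`chain_rule`). It is proved
from smooth approximations, which are part of the definitions of `H¹₀` and of the trace, so that it
also carries approximations to approximations. Traces are followed in this way: subtracting a field
of `H¹₀` leaves the boundary values of the approximations unchanged, and `liftG ∘ lowerG` is the
identity on `𝒩`.

The minimiser `w` exists and is unique because, by the Poincaré inequality, the gradients of the
tangent fields form a closed subspace of `L²` (`isClosed_tangentGrads`) in which the gradient of `w`
is the point nearest to that of `n`. As `w` is orthogonal to the unit field `n`, one has
`‖n - w‖² = 1 + ‖w‖² ≥ 1`.

The energy decreases for three reasons. Outside the unit disc the radial projection contracts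
(`norm_fderiv_smoothProj_apply_le`); the tangent field `0` competes with `w`; and on tangent vectors
of the circle `𝒢` is a similarity with constant ratio, `‖D𝒢 v‖² = (4 Q_c² + M_c²) ‖v‖²`
(`norm_sq_fderiv_mapG`), so that the energies of `Ψ` and of `n` are proportional. For the last point
the derivatives of a unit field have to be tangential, which is the chain rule for `n = P_S ∘ n`.
-/

noncomputable section

namespace Ferronematic

variable {m l : ℕ} {Ω : Set (Eucl 2)} {i : Fin 2} {Qc Mc : ℝ}

/-! ### Weak derivatives -/

/-- The classical `i`-th partial derivative. -/
def pderiv (i : Fin 2) (φ : Eucl 2 → Eucl m) : Eucl 2 → Eucl m :=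
  fun x => fderiv ℝ φ x (EuclideanSpace.single i 1)

theorem isFiniteMeasure_restrict_of_isBounded (hb : Bornology.IsBounded Ω) :
    IsFiniteMeasure ((volume : Measure (Eucl 2)).restrict Ω) :=
  ⟨by simpa using hb.measure_lt_top⟩

theorem memLp_restrict_of_continuous (hb : Bornology.IsBounded Ω) {φ : Eucl 2 → Eucl m}
    (hφ : Continuous φ) : MemLp φ 2 (volume.restrict Ω) := by
  have := isFiniteMeasure_restrict_of_isBounded hb
  have hc : IsCompact (closure Ω) := hb.isCompact_closure
  obtain ⟨C, hC⟩ := (hc.image hφ).isBounded.exists_norm_le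
  refine MemLp.of_bound hφ.aestronglyMeasurable C ?_
  have : ∀ᵐ x ∂((volume : Measure (Eucl 2)).restrict (closure Ω)), ‖φ x‖ ≤ C :=
    (ae_restrict_iff' hc.measurableSet).2
      (ae_of_all _ fun x hx => hC _ (Set.mem_image_of_mem _ hx))
  exact ae_mono (Measure.restrict_mono subset_closure le_rfl) this

theorem memLp_test {ψ : Eucl 2 → ℝ} (h : Continuous ψ) (h' : HasCompactSupport ψ) :
    MemLp ψ 2 (volume.restrict Ω) :=
  (h.memLp_of_hasCompactSupport h').restrict Ω

theorem memLp_fderiv_test {φ : Eucl 2 → ℝ} (h : ContDiff ℝ ∞ φ) (h' : HasCompactSupport φ) :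
    MemLp (fun x => fderiv ℝ φ x (EuclideanSpace.single i 1)) 2 (volume.restrict Ω) :=
  memLp_test ((h.continuous_fderiv (by simp)).clm_apply continuous_const)
    (h'.fderiv_apply ℝ _)

theorem integrable_test_smul {ψ : Eucl 2 → ℝ} {u : Eucl 2 → Eucl m}
    (hψ : MemLp ψ 2 (volume.restrict Ω)) (hu : MemLp u 2 (volume.restrict Ω)) :
    Integrable (fun x => ψ x • u x) (volume.restrict Ω) :=
  memLp_one_iff_integrable.1 (hu.smul hψ)

theorem tendsto_integral_smul {ψ : Eucl 2 → ℝ} {u : Eucl 2 → Eucl m} {v : ℕ → Eucl 2 → Eucl m}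
    (hψ : MemLp ψ 2 (volume.restrict Ω)) (hu : MemLp u 2 (volume.restrict Ω))
    (hv : ∀ k, MemLp (v k) 2 (volume.restrict Ω))
    (h : Tendsto (fun k => eLpNorm (v k - u) 2 (volume.restrict Ω)) atTop (𝓝 0)) :
    Tendsto (fun k => ∫ x in Ω, ψ x • v k x) atTop (𝓝 (∫ x in Ω, ψ x • u x)) := by
  refine tendsto_integral_of_L1' _ (integrable_test_smul hψ hu).1
    (Eventually.of_forall fun k => integrable_test_smul hψ (hv k)) ?_
  have hb : ∀ k, eLpNorm ((fun x => ψ x • v k x) - fun x => ψ x • u x) 1 (volume.restrict Ω) ≤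
      eLpNorm ψ 2 (volume.restrict Ω) * eLpNorm (v k - u) 2 (volume.restrict Ω) := by
    intro k
    have : ((fun x => ψ x • v k x) - fun x => ψ x • u x) = ψ • (v k - u) := by
      ext1 x; simp [smul_sub]
    rw [this]
    exact eLpNorm_smul_le_mul_eLpNorm ((hv k).sub hu).1 hψ.1
  refine tendsto_of_tendsto_of_tendsto_of_le_of_le tendsto_const_nhds ?_ (fun _ => zero_le) hb
  simpa using ENNReal.Tendsto.const_mul h (Or.inr hψ.2.ne)

/-- Weak derivatives are closed under `L²` limits. -/
theorem IsWeakPartial.of_tendsto {u g : Eucl 2 → Eucl m} {v f : ℕ → Eucl 2 → Eucl m}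
    (hu : MemLp u 2 (volume.restrict Ω)) (hg : MemLp g 2 (volume.restrict Ω))
    (hv : ∀ k, MemLp (v k) 2 (volume.restrict Ω)) (hf : ∀ k, MemLp (f k) 2 (volume.restrict Ω))
    (hvf : ∀ k, IsWeakPartial Ω i (v k) (f k))
    (hvu : Tendsto (fun k => eLpNorm (v k - u) 2 (volume.restrict Ω)) atTop (𝓝 0))
    (hfg : Tendsto (fun k => eLpNorm (f k - g) 2 (volume.restrict Ω)) atTop (𝓝 0)) :
    IsWeakPartial Ω i u g := by
  intro φ h1 h2 h3
  have e1 := tendsto_integral_smul (memLp_fderiv_test (i := i) h1 h2) hu hv hvu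
  have e2 := (tendsto_integral_smul (memLp_test h1.continuous h2) hg hf hfg).neg
  refine tendsto_nhds_unique e1 (e2.congr fun k => (hvf k φ h1 h2 h3).symm)

theorem IsWeakPartial.congr {u u' g g' : Eucl 2 → Eucl m} (h : IsWeakPartial Ω i u g)
    (hu : u =ᵐ[volume.restrict Ω] u') (hg : g =ᵐ[volume.restrict Ω] g') :
    IsWeakPartial Ω i u' g' := by
  intro φ h1 h2 h3
  have e1 : ∫ x in Ω, (fderiv ℝ φ x (EuclideanSpace.single i 1)) • u x =
      ∫ x in Ω, (fderiv ℝ φ x (EuclideanSpace.single i 1)) • u' x :=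
    integral_congr_ae (hu.mono fun x hx => by simp only [hx])
  have e2 : ∫ x in Ω, φ x • g x = ∫ x in Ω, φ x • g' x :=
    integral_congr_ae (hg.mono fun x hx => by simp only [hx])
  rw [← e1, ← e2]
  exact h φ h1 h2 h3

/-- Weak derivatives are unique, by the fundamental lemma of the calculus of variations. -/
theorem IsWeakPartial.ae_eq (hΩ : IsOpen Ω) {u g g' : Eucl 2 → Eucl m}
    (hg : MemLp g 2 (volume.restrict Ω)) (hg' : MemLp g' 2 (volume.restrict Ω))
    (h : IsWeakPartial Ω i u g) (h' : IsWeakPartial Ω i u g') : g =ᵐ[volume.restrict Ω] g' := by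
  have hloc : LocallyIntegrableOn (g - g') Ω volume := by
    intro x hx
    obtain ⟨r, hr, hrs⟩ := Metric.isOpen_iff.1 hΩ x hx
    refine ⟨Metric.ball x r, mem_nhdsWithin_of_mem_nhds (Metric.ball_mem_nhds x hr), ?_⟩
    have hm : MemLp (g - g') 2 (volume.restrict (Metric.ball x r)) :=
      (hg.sub hg').mono_measure (Measure.restrict_mono hrs le_rfl)
    have := isFiniteMeasure_restrict_of_isBounded (Metric.isBounded_ball (x := x) (r := r))
    exact hm.integrable (by norm_num)
  have := hΩ.ae_eq_zero_of_integral_contDiff_smul_eq_zero hloc ?_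
  · rw [EventuallyEq, ae_restrict_iff' hΩ.measurableSet]
    filter_upwards [this] with x hx hxΩ
    exact sub_eq_zero.1 (hx hxΩ)
  · intro φ h1 h2 h3
    have hz : ∀ x, x ∉ Ω → φ x • (g - g') x = 0 := fun x hx => by
      rw [image_eq_zero_of_notMem_tsupport (fun h => hx (h3 h)), zero_smul]
    rw [← setIntegral_eq_integral_of_forall_compl_eq_zero hz]
    have hφ := memLp_test (Ω := Ω) h1.continuous h2
    simp only [Pi.sub_apply, smul_sub]
    rw [integral_sub (integrable_test_smul hφ hg) (integrable_test_smul hφ hg')]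
    have a := h φ h1 h2 h3
    have b := h' φ h1 h2 h3
    rw [a] at b
    rw [neg_inj.1 b, sub_self]

theorem IsWeakPartial.sub {u v f g : Eucl 2 → Eucl m}
    (hu : MemLp u 2 (volume.restrict Ω)) (hv : MemLp v 2 (volume.restrict Ω))
    (hf : MemLp f 2 (volume.restrict Ω)) (hg : MemLp g 2 (volume.restrict Ω))
    (huf : IsWeakPartial Ω i u f) (hvg : IsWeakPartial Ω i v g) :
    IsWeakPartial Ω i (u - v) (f - g) := by
  intro φ h1 h2 h3
  have hφ := memLp_test (Ω := Ω) h1.continuous h2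
  have hφ' := memLp_fderiv_test (Ω := Ω) (i := i) h1 h2
  simp only [Pi.sub_apply, smul_sub]
  rw [integral_sub (integrable_test_smul hφ hf) (integrable_test_smul hφ hg),
    integral_sub (integrable_test_smul hφ' hu) (integrable_test_smul hφ' hv),
    huf φ h1 h2 h3, hvg φ h1 h2 h3]
  abel

theorem IsWeakPartial.smul {u f : Eucl 2 → Eucl m} (h : IsWeakPartial Ω i u f) (c : ℝ) :
    IsWeakPartial Ω i (c • u) (c • f) := by
  intro φ h1 h2 h3
  simp only [Pi.smul_apply, smul_comm _ c, integral_smul]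
  rw [h φ h1 h2 h3, smul_neg]

theorem continuous_pderiv {φ : Eucl 2 → Eucl m} (hφ : ContDiff ℝ ∞ φ) :
    Continuous (pderiv i φ) :=
  (hφ.continuous_fderiv (by simp)).clm_apply continuous_const

theorem isWeakPartial_pderiv {φ : Eucl 2 → Eucl m} (hφ : ContDiff ℝ ∞ φ) :
    IsWeakPartial Ω i φ (pderiv i φ) := by
  intro ψ h1 h2 h3
  have hz : ∀ x, x ∉ Ω → fderiv ℝ ψ x (EuclideanSpace.single i 1) • φ x = 0 := fun x hx => by
    rw [image_eq_zero_of_notMem_tsupport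
      (fun h => hx (h3 (tsupport_fderiv_subset ℝ h))), zero_apply, zero_smul]
  have hz' : ∀ x, x ∉ Ω → ψ x • pderiv i φ x = 0 := fun x hx => by
    rw [image_eq_zero_of_notMem_tsupport (fun h => hx (h3 h)), zero_smul]
  rw [setIntegral_eq_integral_of_forall_compl_eq_zero hz,
    setIntegral_eq_integral_of_forall_compl_eq_zero hz']
  have hdψ : Continuous fun x => fderiv ℝ ψ x (EuclideanSpace.single i 1) :=
    (h1.continuous_fderiv (by simp)).clm_apply continuous_const
  rw [eq_neg_iff_add_eq_zero, add_comm, ← eq_neg_iff_add_eq_zero]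
  refine integral_smul_fderiv_eq_neg_fderiv_smul_of_integrable ?_ ?_ ?_ ?_ ?_
  · exact (hdψ.smul hφ.continuous).integrable_of_hasCompactSupport
      (h2.fderiv_apply ℝ _).smul_right
  · exact (h1.continuous.smul (continuous_pderiv hφ)).integrable_of_hasCompactSupport h2.smul_right
  · exact (h1.continuous.smul hφ.continuous).integrable_of_hasCompactSupport h2.smul_right
  · exact fun x _ => h1.differentiable (by simp) x
  · exact fun x _ => hφ.differentiable (by simp) x

theorem memLp_pderiv (hb : Bornology.IsBounded Ω) {φ : Eucl 2 → Eucl m} (hφ : ContDiff ℝ ∞ φ) :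
    MemLp (pderiv i φ) 2 (volume.restrict Ω) :=
  memLp_restrict_of_continuous hb (continuous_pderiv hφ)

/-! ### The chosen weak derivative -/

theorem MemH1.memLp_weakPartial {u : Eucl 2 → Eucl m} (h : MemH1 Ω u) (i : Fin 2) :
    MemLp (weakPartial Ω i u) 2 (volume.restrict Ω) := by
  rw [weakPartial, dif_pos (h.2 i)]
  exact (h.2 i).choose_spec.1

theorem MemH1.isWeakPartial_weakPartial {u : Eucl 2 → Eucl m} (h : MemH1 Ω u) (i : Fin 2) :
    IsWeakPartial Ω i u (weakPartial Ω i u) := by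
  rw [weakPartial, dif_pos (h.2 i)]
  exact (h.2 i).choose_spec.2

theorem weakPartial_ae_eq (hΩ : IsOpen Ω) {u g : Eucl 2 → Eucl m}
    (hg : MemLp g 2 (volume.restrict Ω)) (h : IsWeakPartial Ω i u g) :
    weakPartial Ω i u =ᵐ[volume.restrict Ω] g := by
  have hu : HasL2WeakPartial Ω i u := ⟨g, hg, h⟩
  rw [weakPartial, dif_pos hu]
  exact hu.choose_spec.2.ae_eq hΩ hu.choose_spec.1 hg h

theorem memH1_of_contDiff (hb : Bornology.IsBounded Ω) {φ : Eucl 2 → Eucl m}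
    (hφ : ContDiff ℝ ∞ φ) : MemH1 Ω φ :=
  ⟨memLp_restrict_of_continuous hb hφ.continuous,
    fun _ => ⟨_, memLp_pderiv hb hφ, isWeakPartial_pderiv hφ⟩⟩

theorem MemH1.congr {u v : Eucl 2 → Eucl m} (h : MemH1 Ω u) (huv : u =ᵐ[volume.restrict Ω] v) :
    MemH1 Ω v :=
  ⟨(memLp_congr_ae huv).1 h.1, fun i =>
    ⟨_, h.memLp_weakPartial i, (h.isWeakPartial_weakPartial i).congr huv .rfl⟩⟩

theorem MemH1.sub {u v : Eucl 2 → Eucl m} (hu : MemH1 Ω u) (hv : MemH1 Ω v) : MemH1 Ω (u - v) :=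
  ⟨hu.1.sub hv.1, fun i => ⟨_, (hu.memLp_weakPartial i).sub (hv.memLp_weakPartial i),
    (hu.isWeakPartial_weakPartial i).sub hu.1 hv.1 (hu.memLp_weakPartial i)
      (hv.memLp_weakPartial i) (hv.isWeakPartial_weakPartial i)⟩⟩

theorem MemH1.smul {u : Eucl 2 → Eucl m} (hu : MemH1 Ω u) (c : ℝ) : MemH1 Ω (c • u) :=
  ⟨hu.1.const_smul c, fun i => ⟨_, (hu.memLp_weakPartial i).const_smul c,
    (hu.isWeakPartial_weakPartial i).smul c⟩⟩

theorem weakPartial_smul (hΩ : IsOpen Ω) {u : Eucl 2 → Eucl m} (hu : MemH1 Ω u) (c : ℝ) :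
    weakPartial Ω i (c • u) =ᵐ[volume.restrict Ω] c • weakPartial Ω i u :=
  weakPartial_ae_eq hΩ ((hu.memLp_weakPartial i).const_smul c)
    ((hu.isWeakPartial_weakPartial i).smul c)

theorem weakPartial_sub (hΩ : IsOpen Ω) {u v : Eucl 2 → Eucl m} (hu : MemH1 Ω u)
    (hv : MemH1 Ω v) : weakPartial Ω i (u - v) =ᵐ[volume.restrict Ω]
      weakPartial Ω i u - weakPartial Ω i v :=
  weakPartial_ae_eq hΩ ((hu.memLp_weakPartial i).sub (hv.memLp_weakPartial i))
    ((hu.isWeakPartial_weakPartial i).sub hu.1 hv.1 (hu.memLp_weakPartial i)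
      (hv.memLp_weakPartial i) (hv.isWeakPartial_weakPartial i))

theorem MemH1.weakPartial_congr (hΩ : IsOpen Ω) {u v : Eucl 2 → Eucl m} (hu : MemH1 Ω u)
    (huv : u =ᵐ[volume.restrict Ω] v) :
    weakPartial Ω i v =ᵐ[volume.restrict Ω] weakPartial Ω i u :=
  weakPartial_ae_eq hΩ (hu.memLp_weakPartial i) ((hu.isWeakPartial_weakPartial i).congr huv .rfl)

theorem weakPartial_contDiff (hΩ : IsOpen Ω) (hb : Bornology.IsBounded Ω) {φ : Eucl 2 → Eucl m}
    (hφ : ContDiff ℝ ∞ φ) : weakPartial Ω i φ =ᵐ[volume.restrict Ω] pderiv i φ :=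
  weakPartial_ae_eq hΩ (memLp_pderiv hb hφ) (isWeakPartial_pderiv hφ)

/-- For smooth `φ`, the `H¹` distance to `u` is computed from the classical derivatives of `φ`. -/
theorem h1Norm_contDiff_sub (hΩ : IsOpen Ω) (hb : Bornology.IsBounded Ω) {φ u : Eucl 2 → Eucl m}
    (hφ : ContDiff ℝ ∞ φ) (hu : MemH1 Ω u) :
    h1Norm Ω (φ - u) = eLpNorm (φ - u) 2 (volume.restrict Ω) +
      ∑ i, eLpNorm (pderiv i φ - weakPartial Ω i u) 2 (volume.restrict Ω) := by
  unfold h1Norm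
  congr 1
  refine Finset.sum_congr rfl fun i _ => eLpNorm_congr_ae ?_
  exact (weakPartial_sub hΩ (memH1_of_contDiff hb hφ) hu).trans
    ((weakPartial_contDiff hΩ hb hφ).sub .rfl)

theorem tendsto_h1Norm_iff (hΩ : IsOpen Ω) (hb : Bornology.IsBounded Ω) {u : Eucl 2 → Eucl m}
    {φ : ℕ → Eucl 2 → Eucl m} (hφ : ∀ k, ContDiff ℝ ∞ (φ k)) (hu : MemH1 Ω u) :
    Tendsto (fun k => h1Norm Ω (φ k - u)) atTop (𝓝 0) ↔
      Tendsto (fun k => eLpNorm (φ k - u) 2 (volume.restrict Ω)) atTop (𝓝 0) ∧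
      ∀ i, Tendsto (fun k => eLpNorm (pderiv i (φ k) - weakPartial Ω i u) 2 (volume.restrict Ω))
        atTop (𝓝 0) := by
  simp only [h1Norm_contDiff_sub hΩ hb (hφ _) hu]
  constructor
  · intro h
    refine ⟨tendsto_of_tendsto_of_tendsto_of_le_of_le tendsto_const_nhds h (fun _ => zero_le)
      fun k => le_self_add, fun i => tendsto_of_tendsto_of_tendsto_of_le_of_le tendsto_const_nhds h
      (fun _ => zero_le) fun k => ?_⟩
    exact (Finset.single_le_sum (f := fun i =>
      eLpNorm (pderiv i (φ k) - weakPartial Ω i u) 2 (volume.restrict Ω))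
      (fun _ _ => zero_le) (Finset.mem_univ i)).trans le_add_self
  · rintro ⟨h, h'⟩
    simpa using h.add (tendsto_finsetSum Finset.univ fun i _ => h' i)

theorem h1Norm_congr (hΩ : IsOpen Ω) {u v : Eucl 2 → Eucl m} (hu : MemH1 Ω u)
    (huv : u =ᵐ[volume.restrict Ω] v) : h1Norm Ω v = h1Norm Ω u := by
  unfold h1Norm
  rw [eLpNorm_congr_ae huv]
  congr 1
  exact Finset.sum_congr rfl fun i _ => eLpNorm_congr_ae (hu.weakPartial_congr hΩ huv)

theorem energy_congr (hΩ : IsOpen Ω) {u v : Eucl 2 → Eucl m} (hu : MemH1 Ω u)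
    (huv : u =ᵐ[volume.restrict Ω] v) : energy Ω v = energy Ω u := by
  unfold energy
  congr 1
  refine integral_congr_ae ?_
  filter_upwards [hu.weakPartial_congr (i := 0) hΩ huv, hu.weakPartial_congr (i := 1) hΩ huv]
    with x h0 h1
  simp [Fin.sum_univ_two, h0, h1]

/-! ### The chain rule -/

/-- Dominated convergence to `0` in `L²`. -/
theorem tendsto_eLpNorm_two_of_dominated {α E : Type*} [MeasurableSpace α] {μ : Measure α}
    [NormedAddCommGroup E] {f : ℕ → α → E} {B : α → ℝ}
    (hf : ∀ k, AEStronglyMeasurable (f k) μ) (hB : MemLp B 2 μ)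
    (hfB : ∀ k, ∀ᵐ x ∂μ, ‖f k x‖ ≤ B x)
    (h : ∀ᵐ x ∂μ, Tendsto (fun k => f k x) atTop (𝓝 0)) :
    Tendsto (fun k => eLpNorm (f k) 2 μ) atTop (𝓝 0) := by
  have key : Tendsto (fun k => ∫⁻ x, ‖f k x‖ₑ ^ (2 : ℝ) ∂μ) atTop (𝓝 (∫⁻ _, 0 ∂μ)) := by
    refine tendsto_lintegral_of_dominated_convergence' (fun x => ‖B x‖ₑ ^ (2 : ℝ))
      (fun k => (hf k).enorm.pow_const _) ?_ ?_ ?_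
    · intro k
      filter_upwards [hfB k] with x hx
      refine ENNReal.rpow_le_rpow ?_ (by norm_num)
      exact enorm_le_iff_norm_le.2 (hx.trans (le_abs_self _))
    · have := hB.2
      rw [eLpNorm_lt_top_iff_lintegral_rpow_enorm_lt_top (by norm_num) (by norm_num)] at this
      simpa using this.ne
    · filter_upwards [h] with x hx
      have h1 : Tendsto (fun k => ‖f k x‖ₑ) atTop (𝓝 0) := by simpa using hx.enorm
      have := (ENNReal.continuous_rpow_const (y := (2 : ℝ))).tendsto 0 |>.comp h1
      simpa [Function.comp_def] using this
  rw [lintegral_zero] at key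
  have := (ENNReal.continuous_rpow_const (y := (1 / 2 : ℝ))).tendsto 0 |>.comp key
  simp only [eLpNorm_eq_lintegral_rpow_enorm_toReal (p := 2) (by norm_num) (by norm_num)]
  simpa [Function.comp_def] using this

theorem tendsto_eLpNorm_of_le_mul {α E G : Type*} [MeasurableSpace α] {μ : Measure α}
    [NormedAddCommGroup E] [NormedAddCommGroup G] {f : ℕ → α → E} {g : ℕ → α → G} {C : ℝ}
    (hfg : ∀ k, ∀ᵐ x ∂μ, ‖f k x‖ ≤ C * ‖g k x‖)
    (h : Tendsto (fun k => eLpNorm (g k) 2 μ) atTop (𝓝 0)) :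
    Tendsto (fun k => eLpNorm (f k) 2 μ) atTop (𝓝 0) := by
  refine tendsto_of_tendsto_of_tendsto_of_le_of_le tendsto_const_nhds ?_ (fun _ => zero_le)
    fun k => eLpNorm_le_mul_eLpNorm_of_ae_le_mul (hfg k) 2
  simpa using ENNReal.Tendsto.const_mul h (Or.inr ENNReal.ofReal_ne_top)

theorem norm_sub_le_of_fderiv_bound {F : Eucl m → Eucl l} (hF : ContDiff ℝ ∞ F) {C : ℝ}
    (hC : ∀ y, ‖fderiv ℝ F y‖ ≤ C) (a b : Eucl m) : ‖F a - F b‖ ≤ C * ‖a - b‖ :=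
  convex_univ.norm_image_sub_le_of_norm_fderiv_le
    (fun x _ => hF.differentiable (by simp) x) (fun x _ => hC x) (Set.mem_univ b) (Set.mem_univ a)

theorem pderiv_comp {F : Eucl m → Eucl l} (hF : ContDiff ℝ ∞ F) {φ : Eucl 2 → Eucl m}
    (hφ : ContDiff ℝ ∞ φ) (x : Eucl 2) :
    pderiv i (F ∘ φ) x = fderiv ℝ F (φ x) (pderiv i φ x) := by
  unfold pderiv
  rw [fderiv_comp x (hF.differentiable (by simp) _) (hφ.differentiable (by simp) _)]
  rfl

/-- **Chain rule in `H¹`**. Composing with a smooth map with bounded derivative preserves `H¹`,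
the weak derivatives obey the chain rule, and smooth approximations are carried, along a
subsequence, to smooth approximations. -/
theorem chain_rule (hΩ : IsOpen Ω) (hb : Bornology.IsBounded Ω) {F : Eucl m → Eucl l}
    (hF : ContDiff ℝ ∞ F) {C : ℝ} (hC : ∀ y, ‖fderiv ℝ F y‖ ≤ C) {u : Eucl 2 → Eucl m}
    (hu : MemH1 Ω u) {φ : ℕ → Eucl 2 → Eucl m} (hφ : ∀ k, ContDiff ℝ ∞ (φ k))
    (hφu : Tendsto (fun k => h1Norm Ω (φ k - u)) atTop (𝓝 0)) :
    MemH1 Ω (F ∘ u) ∧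
    (∀ i, weakPartial Ω i (F ∘ u) =ᵐ[volume.restrict Ω]
      fun x => fderiv ℝ F (u x) (weakPartial Ω i u x)) ∧
    ∃ ns : ℕ → ℕ, StrictMono ns ∧
      Tendsto (fun k => h1Norm Ω (F ∘ φ (ns k) - F ∘ u)) atTop (𝓝 0) := by
  have hfin := isFiniteMeasure_restrict_of_isBounded hb
  have hC0 : 0 ≤ C := (norm_nonneg _).trans (hC 0)
  obtain ⟨hL, hD⟩ := (tendsto_h1Norm_iff hΩ hb hφ hu).1 hφu
  have hFd : Continuous (fderiv ℝ F) := hF.continuous_fderiv (by simp)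
  -- the composite is square integrable
  have hFu : MemLp (F ∘ u) 2 (volume.restrict Ω) := by
    have h1 : MemLp (fun x => F (u x) - F 0) 2 (volume.restrict Ω) := by
      refine MemLp.of_le_mul (c := C) hu.1
        ((hF.continuous.comp_aestronglyMeasurable hu.1.1).sub aestronglyMeasurable_const)
        (ae_of_all _ fun x => ?_)
      simpa using norm_sub_le_of_fderiv_bound hF hC (u x) 0
    have := h1.add (memLp_const (F 0))
    refine (memLp_congr_ae (ae_of_all _ fun x => ?_)).1 this
    simp
  have hg : ∀ i, MemLp (fun x => fderiv ℝ F (u x) (weakPartial Ω i u x)) 2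
      (volume.restrict Ω) := fun i => by
    refine MemLp.of_le_mul (c := C) (hu.memLp_weakPartial i) ?_ (ae_of_all _ fun x => ?_)
    · exact (ContinuousLinearMap.apply ℝ (Eucl l)).flip.aestronglyMeasurable_comp₂
        (hFd.comp_aestronglyMeasurable hu.1.1) (hu.memLp_weakPartial i).1
    · exact ((fderiv ℝ F (u x)).le_opNorm _).trans
        (mul_le_mul_of_nonneg_right (hC _) (norm_nonneg _))
  have hFφ : ∀ k, ContDiff ℝ ∞ (F ∘ φ k) := fun k => hF.comp (hφ k)
  obtain ⟨ns, hns, hae⟩ := (tendstoInMeasure_of_tendsto_eLpNorm (by norm_num)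
    (fun k => (hφ k).continuous.aestronglyMeasurable) hu.1.1 hL).exists_seq_tendsto_ae
  have hL' := tendsto_eLpNorm_of_le_mul (f := fun k => F ∘ φ (ns k) - F ∘ u) (C := C)
    (fun k => ae_of_all _ fun x => norm_sub_le_of_fderiv_bound hF hC (φ (ns k) x) (u x))
    (hL.comp hns.tendsto_atTop)
  have hD' : ∀ i, Tendsto (fun k => eLpNorm (pderiv i (F ∘ φ (ns k)) -
      fun x => fderiv ℝ F (u x) (weakPartial Ω i u x)) 2 (volume.restrict Ω)) atTop (𝓝 0) := by
    intro i
    -- split into the change of the derivative of `φ` and the change of the base point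
    set A : ℕ → Eucl 2 → Eucl l := fun k x =>
      fderiv ℝ F (φ (ns k) x) (pderiv i (φ (ns k)) x - weakPartial Ω i u x) with hA
    set B : ℕ → Eucl 2 → Eucl l := fun k x =>
      (fderiv ℝ F (φ (ns k) x) - fderiv ℝ F (u x)) (weakPartial Ω i u x) with hB
    have hAB : ∀ k, (pderiv i (F ∘ φ (ns k)) -
        fun x => fderiv ℝ F (u x) (weakPartial Ω i u x)) = A k + B k := fun k => by
      ext1 x
      simp [hA, hB, pderiv_comp hF (hφ (ns k))]
    have hFm : ∀ k, AEStronglyMeasurable (fun x => fderiv ℝ F (φ (ns k) x))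
        (volume.restrict Ω) := fun k =>
      (hFd.comp (hφ (ns k)).continuous).aestronglyMeasurable
    have mA : ∀ k, AEStronglyMeasurable (A k) (volume.restrict Ω) := fun k =>
      (ContinuousLinearMap.apply ℝ (Eucl l)).flip.aestronglyMeasurable_comp₂
        (hFm k)
        ((continuous_pderiv (hφ (ns k))).aestronglyMeasurable.sub (hu.memLp_weakPartial i).1)
    have mB : ∀ k, AEStronglyMeasurable (B k) (volume.restrict Ω) := fun k =>
      (ContinuousLinearMap.apply ℝ (Eucl l)).flip.aestronglyMeasurable_comp₂
        ((hFm k).sub (hFd.comp_aestronglyMeasurable hu.1.1)) (hu.memLp_weakPartial i).1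
    have tA : Tendsto (fun k => eLpNorm (A k) 2 (volume.restrict Ω)) atTop (𝓝 0) :=
      tendsto_eLpNorm_of_le_mul (C := C)
        (fun k => ae_of_all _ fun x => ((fderiv ℝ F (φ (ns k) x)).le_opNorm _).trans
          (mul_le_mul_of_nonneg_right (hC _) (norm_nonneg _)))
        ((hD i).comp hns.tendsto_atTop)
    have tB : Tendsto (fun k => eLpNorm (B k) 2 (volume.restrict Ω)) atTop (𝓝 0) := by
      refine tendsto_eLpNorm_two_of_dominated (B := fun x => (C + C) * ‖weakPartial Ω i u x‖) mB
        ((hu.memLp_weakPartial i).norm.const_mul _) (fun k => ae_of_all _ fun x => ?_) ?_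
      · refine (ContinuousLinearMap.le_opNorm _ _).trans
          (mul_le_mul_of_nonneg_right ?_ (norm_nonneg _))
        exact (norm_sub_le _ _).trans (add_le_add (hC _) (hC _))
      · filter_upwards [hae] with x hx
        have h1 : Tendsto (fun k => fderiv ℝ F (φ (ns k) x) - fderiv ℝ F (u x)) atTop (𝓝 0) := by
          simpa using ((hFd.tendsto (u x)).comp hx).sub_const (fderiv ℝ F (u x))
        have := ((ContinuousLinearMap.apply ℝ (Eucl l) (weakPartial Ω i u x)).continuous.tendsto
          0).comp h1
        simpa [Function.comp_def, hB] using this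
    simp only [hAB]
    refine tendsto_of_tendsto_of_tendsto_of_le_of_le tendsto_const_nhds
      (by simpa using tA.add tB) (fun _ => zero_le) fun k =>
        eLpNorm_add_le (mA k) (mB k) (by norm_num)
  have hw : ∀ i, IsWeakPartial Ω i (F ∘ u) fun x => fderiv ℝ F (u x) (weakPartial Ω i u x) :=
    fun i => IsWeakPartial.of_tendsto hFu (hg i)
      (fun k => memLp_restrict_of_continuous hb (hFφ (ns k)).continuous)
      (fun k => memLp_pderiv hb (hFφ (ns k))) (fun k => isWeakPartial_pderiv (hFφ (ns k))) hL'
      (hD' i)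
  have hH : MemH1 Ω (F ∘ u) := ⟨hFu, fun i => ⟨_, hg i, hw i⟩⟩
  have hae' : ∀ i, weakPartial Ω i (F ∘ u) =ᵐ[volume.restrict Ω]
      fun x => fderiv ℝ F (u x) (weakPartial Ω i u x) :=
    fun i => weakPartial_ae_eq hΩ (hg i) (hw i)
  refine ⟨hH, hae', ns, hns, (tendsto_h1Norm_iff hΩ hb (fun k => hFφ (ns k)) hH).2
    ⟨hL', fun i => (hD' i).congr fun k => eLpNorm_congr_ae ?_⟩⟩
  exact EventuallyEq.rfl.sub (hae' i).symm

/-! ### Fields vanishing on the boundary and the Poincaré inequality -/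

theorem pderiv_sub {φ ψ : Eucl 2 → Eucl m} (hφ : ContDiff ℝ ∞ φ) (hψ : ContDiff ℝ ∞ ψ) :
    pderiv i (φ - ψ) = pderiv i φ - pderiv i ψ := by
  ext1 x
  simp only [pderiv, Pi.sub_apply]
  rw [fderiv_sub (hφ.differentiable (by simp) x) (hψ.differentiable (by simp) x)]
  rfl

theorem pderiv_smul {φ : Eucl 2 → Eucl m} (hφ : ContDiff ℝ ∞ φ) (c : ℝ) :
    pderiv i (c • φ) = c • pderiv i φ := by
  ext1 x
  simp only [pderiv, Pi.smul_apply]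
  rw [fderiv_const_smul (hφ.differentiable (by simp) x)]
  rfl

theorem tendsto_eLpNorm_sub_sub {α E : Type*} [MeasurableSpace α] {μ : Measure α}
    [NormedAddCommGroup E] {f g : ℕ → α → E} {u v : α → E}
    (hf : ∀ k, AEStronglyMeasurable (f k) μ) (hg : ∀ k, AEStronglyMeasurable (g k) μ)
    (hu : AEStronglyMeasurable u μ) (hv : AEStronglyMeasurable v μ)
    (hfu : Tendsto (fun k => eLpNorm (f k - u) 2 μ) atTop (𝓝 0))
    (hgv : Tendsto (fun k => eLpNorm (g k - v) 2 μ) atTop (𝓝 0)) :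
    Tendsto (fun k => eLpNorm ((f k - g k) - (u - v)) 2 μ) atTop (𝓝 0) := by
  refine tendsto_of_tendsto_of_tendsto_of_le_of_le tendsto_const_nhds
    (by simpa using hfu.add hgv) (fun _ => zero_le) fun k => ?_
  rw [sub_sub_sub_comm]
  exact eLpNorm_sub_le ((hf k).sub hu) ((hg k).sub hv) (by norm_num)

theorem tendsto_h1Norm_sub_sub (hΩ : IsOpen Ω) (hb : Bornology.IsBounded Ω)
    {u v : Eucl 2 → Eucl m} {φ ψ : ℕ → Eucl 2 → Eucl m} (hφ : ∀ k, ContDiff ℝ ∞ (φ k))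
    (hψ : ∀ k, ContDiff ℝ ∞ (ψ k)) (hu : MemH1 Ω u) (hv : MemH1 Ω v)
    (hφu : Tendsto (fun k => h1Norm Ω (φ k - u)) atTop (𝓝 0))
    (hψv : Tendsto (fun k => h1Norm Ω (ψ k - v)) atTop (𝓝 0)) :
    Tendsto (fun k => h1Norm Ω ((φ k - ψ k) - (u - v))) atTop (𝓝 0) := by
  rw [tendsto_h1Norm_iff hΩ hb hφ hu] at hφu
  rw [tendsto_h1Norm_iff hΩ hb hψ hv] at hψv
  have hs : ∀ k, ContDiff ℝ ∞ (φ k - ψ k) := fun k => (hφ k).sub (hψ k)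
  refine (tendsto_h1Norm_iff hΩ hb hs (hu.sub hv)).2
    ⟨tendsto_eLpNorm_sub_sub (fun k => (hφ k).continuous.aestronglyMeasurable)
      (fun k => (hψ k).continuous.aestronglyMeasurable) hu.1.1 hv.1.1 hφu.1 hψv.1, fun i => ?_⟩
  refine (tendsto_eLpNorm_sub_sub
      (fun k => (continuous_pderiv (i := i) (hφ k)).aestronglyMeasurable)
      (fun k => (continuous_pderiv (hψ k)).aestronglyMeasurable) (hu.memLp_weakPartial i).1
      (hv.memLp_weakPartial i).1 (hφu.2 i) (hψv.2 i)).congr fun k => eLpNorm_congr_ae ?_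
  rw [pderiv_sub (hφ k) (hψ k)]
  exact EventuallyEq.rfl.sub (weakPartial_sub hΩ hu hv).symm

theorem MemH10.sub (hΩ : IsOpen Ω) (hb : Bornology.IsBounded Ω) {u v : Eucl 2 → Eucl m}
    (hu : MemH10 Ω u) (hv : MemH10 Ω v) : MemH10 Ω (u - v) := by
  obtain ⟨hu, φ, hφ, hφu⟩ := hu
  obtain ⟨hv, ψ, hψ, hψv⟩ := hv
  refine ⟨hu.sub hv, fun k => φ k - ψ k, fun k => ⟨(hφ k).1.sub (hψ k).1,
    (hφ k).2.1.sub (hψ k).2.1, (tsupport_sub _ _).trans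
      (Set.union_subset (hφ k).2.2 (hψ k).2.2)⟩, ?_⟩
  exact tendsto_h1Norm_sub_sub hΩ hb (fun k => (hφ k).1) (fun k => (hψ k).1) hu hv hφu hψv

theorem MemH10.smul (hΩ : IsOpen Ω) (hb : Bornology.IsBounded Ω) {u : Eucl 2 → Eucl m}
    (hu : MemH10 Ω u) (c : ℝ) : MemH10 Ω (c • u) := by
  obtain ⟨hu, φ, hφ, hφu⟩ := hu
  have hs : ∀ k, ContDiff ℝ ∞ (c • φ k) := fun k => (hφ k).1.const_smul c
  refine ⟨hu.smul c, fun k => c • φ k, fun k => ⟨hs k, (hφ k).2.1.smul_left,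
    (tsupport_smul_subset_right (fun _ => c) (φ k)).trans (hφ k).2.2⟩, ?_⟩
  rw [tendsto_h1Norm_iff hΩ hb (fun k => (hφ k).1) hu] at hφu
  refine (tendsto_h1Norm_iff hΩ hb hs (hu.smul c)).2
    ⟨tendsto_eLpNorm_of_le_mul (C := ‖c‖) (fun k => ae_of_all _ fun x => ?_) hφu.1, fun i =>
      tendsto_eLpNorm_of_le_mul (C := ‖c‖) (fun k => ?_) (hφu.2 i)⟩
  · simp [← smul_sub, norm_smul]
  · filter_upwards [weakPartial_smul (i := i) hΩ hu c] with x hx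
    simp [hx, pderiv_smul (hφ k).1, ← smul_sub, norm_smul]

theorem memH1_zero : MemH1 Ω (0 : Eucl 2 → Eucl m) :=
  ⟨MemLp.zero, fun _ => ⟨0, MemLp.zero, fun φ _ _ _ => by simp⟩⟩

theorem memH10_zero (hΩ : IsOpen Ω) (hb : Bornology.IsBounded Ω) :
    MemH10 Ω (0 : Eucl 2 → Eucl m) := by
  refine ⟨memH1_zero, fun _ => 0, fun k => ⟨contDiff_const, HasCompactSupport.zero, ?_⟩, ?_⟩
  · simp [tsupport]
  · have h0 : (0 : Eucl 2 → Eucl m) - 0 = 0 := sub_self 0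
    have : h1Norm Ω ((0 : Eucl 2 → Eucl m) - 0) = 0 := by
      have hz : ContDiff ℝ ∞ (0 : Eucl 2 → Eucl m) := contDiff_const
      rw [h1Norm_contDiff_sub hΩ hb hz memH1_zero]
      have h1 : ∀ i, pderiv i (0 : Eucl 2 → Eucl m) - weakPartial Ω i 0
          =ᵐ[volume.restrict Ω] 0 := fun i => by
        filter_upwards [weakPartial_contDiff (m := m) (i := i) hΩ hb (φ := 0) contDiff_const]
          with x hx
        simp [hx]
      simp only [h0, eLpNorm_congr_ae (h1 _)]
      simp
    simp only [this, tendsto_const_nhds_iff]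

theorem norm_fderiv_le_sum_pderiv (φ : Eucl 2 → Eucl m) (x : Eucl 2) :
    ‖fderiv ℝ φ x‖ ≤ ∑ i, ‖pderiv i φ x‖ := by
  refine ContinuousLinearMap.opNorm_le_bound _ (Finset.sum_nonneg fun _ _ => norm_nonneg _)
    fun v => ?_
  have hv : v = ∑ i, v i • EuclideanSpace.single i (1 : ℝ) := by
    ext j
    fin_cases j <;> simp [Fin.sum_univ_two]
  calc ‖fderiv ℝ φ x v‖ = ‖∑ i, v i • pderiv i φ x‖ := by
        conv_lhs => rw [hv]
        simp [pderiv]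
    _ ≤ ∑ i, ‖v i • pderiv i φ x‖ := norm_sum_le _ _
    _ ≤ ∑ i, ‖pderiv i φ x‖ * ‖v‖ := Finset.sum_le_sum fun i _ => by
        rw [norm_smul, mul_comm]
        exact mul_le_mul_of_nonneg_left (PiLp.norm_apply_le v i) (norm_nonneg _)
    _ = _ := (Finset.sum_mul ..).symm

/-- The Gagliardo–Nirenberg–Sobolev inequality at the critical exponent of the plane. -/
theorem exists_sobolev_one (m : ℕ) :
    ∃ c : NNReal, ∀ φ : Eucl 2 → Eucl m, ContDiff ℝ ∞ φ → HasCompactSupport φ →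
      eLpNorm φ 2 volume ≤ c * eLpNorm (fderiv ℝ φ) 1 volume := by
  refine ⟨eLpNormLESNormFDerivOneConst (volume : Measure (Eucl 2)) (2 : NNReal),
    fun φ h1 h2 => ?_⟩
  have hconj : NNReal.HolderConjugate (Module.finrank ℝ (Eucl 2)) 2 := by
    rw [finrank_euclideanSpace_fin]
    exact_mod_cast NNReal.HolderConjugate.two_two
  exact eLpNorm_le_eLpNorm_fderiv_one (volume : Measure (Eucl 2)) (h1.of_le (by simp)) h2 hconj

/-- **Poincaré inequality** for test fields. In the plane it is the Gagliardo–Nirenberg–Sobolev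
inequality `‖φ‖₂ ≤ C ‖∇φ‖₁` followed by Cauchy–Schwarz. -/
theorem exists_poincare_test (hb : Bornology.IsBounded Ω) (m : ℕ) :
    ∃ C : NNReal, ∀ φ : Eucl 2 → Eucl m, ContDiff ℝ ∞ φ → HasCompactSupport φ →
      tsupport φ ⊆ Ω → eLpNorm φ 2 (volume.restrict Ω) ≤
        C * ∑ i, eLpNorm (pderiv i φ) 2 (volume.restrict Ω) := by
  have hfin := isFiniteMeasure_restrict_of_isBounded hb
  obtain ⟨M, hM, hMtop⟩ : ∃ M : ℝ≥0∞,
      ((volume : Measure (Eucl 2)).restrict Ω) Set.univ ^ (1 / 2 : ℝ) = M ∧ M ≠ ⊤ :=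
    ⟨_, rfl, ENNReal.rpow_ne_top_of_nonneg (by norm_num) (measure_ne_top _ _)⟩
  obtain ⟨c, hc⟩ := exists_sobolev_one m
  refine ⟨c * M.toNNReal, fun φ h1 h2 h3 => ?_⟩
  have hs : Function.support (fun x => ‖fderiv ℝ φ x‖) ⊆ Ω := fun x hx =>
    h3 (tsupport_fderiv_subset ℝ (subset_tsupport _ (fun h => hx (by simp [h]))))
  have hres : eLpNorm (fderiv ℝ φ) 1 (volume.restrict Ω) = eLpNorm (fderiv ℝ φ) 1 volume := by
    rw [← eLpNorm_norm, ← eLpNorm_norm (fderiv ℝ φ)]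
    exact eLpNorm_restrict_eq_of_support_subset hs
  have hle : eLpNorm (fderiv ℝ φ) 1 (volume.restrict Ω) ≤
      ∑ i, eLpNorm (pderiv i φ) 1 (volume.restrict Ω) := by
    have hm : ∀ i, AEStronglyMeasurable (fun x => ‖pderiv i φ x‖) (volume.restrict Ω) :=
      fun i => (continuous_pderiv h1).norm.aestronglyMeasurable
    calc _ ≤ eLpNorm (∑ i, fun x => ‖pderiv i φ x‖) 1 (volume.restrict Ω) := by
          refine eLpNorm_mono_ae (ae_of_all _ fun x => ?_)
          refine (norm_fderiv_le_sum_pderiv φ x).trans ?_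
          simp only [Finset.sum_apply]
          exact le_abs_self _
      _ ≤ ∑ i, eLpNorm (fun x => ‖pderiv i φ x‖) 1 (volume.restrict Ω) :=
          eLpNorm_sum_le (fun i _ => hm i) le_rfl
      _ = _ := by simp only [eLpNorm_norm]
  have hcs : ∀ i, eLpNorm (pderiv i φ) 1 (volume.restrict Ω) ≤
      eLpNorm (pderiv i φ) 2 (volume.restrict Ω) * M := fun i => by
    have := eLpNorm_le_eLpNorm_mul_rpow_measure_univ (p := 1) (q := 2)
      (μ := (volume : Measure (Eucl 2)).restrict Ω) (by norm_num)
      (continuous_pderiv (i := i) h1).aestronglyMeasurable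
    have he : (1 / (1 : ℝ≥0∞).toReal - 1 / (2 : ℝ≥0∞).toReal : ℝ) = 1 / 2 := by norm_num
    rwa [he, hM] at this
  calc eLpNorm φ 2 (volume.restrict Ω) ≤ eLpNorm φ 2 volume :=
        eLpNorm_mono_measure _ Measure.restrict_le_self
    _ ≤ c * eLpNorm (fderiv ℝ φ) 1 volume := hc φ h1 h2
    _ = c * eLpNorm (fderiv ℝ φ) 1 (volume.restrict Ω) := by rw [hres]
    _ ≤ c * ∑ i, eLpNorm (pderiv i φ) 2 (volume.restrict Ω) * M := by
        gcongr
        exact hle.trans (Finset.sum_le_sum fun i _ => hcs i)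
    _ = _ := by
        rw [← Finset.sum_mul, ENNReal.coe_mul, ENNReal.coe_toNNReal hMtop]
        ring

theorem tendsto_eLpNorm_of_tendsto_sub {α E : Type*} [MeasurableSpace α] {μ : Measure α}
    [NormedAddCommGroup E] {f : ℕ → α → E} {u : α → E}
    (hf : ∀ k, MemLp (f k) 2 μ) (hu : MemLp u 2 μ)
    (hfu : Tendsto (fun k => eLpNorm (f k - u) 2 μ) atTop (𝓝 0)) :
    Tendsto (fun k => eLpNorm (f k) 2 μ) atTop (𝓝 (eLpNorm u 2 μ)) := by
  have := (Lp.tendsto_Lp_iff_tendsto_eLpNorm'' f hf u hu).2 hfu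
  simpa only [Lp.enorm_toLp] using this.enorm

theorem exists_poincare (hΩ : IsOpen Ω) (hb : Bornology.IsBounded Ω) (m : ℕ) :
    ∃ C : NNReal, ∀ u : Eucl 2 → Eucl m, MemH10 Ω u → eLpNorm u 2 (volume.restrict Ω) ≤
        C * ∑ i, eLpNorm (weakPartial Ω i u) 2 (volume.restrict Ω) := by
  obtain ⟨C, hC⟩ := exists_poincare_test hb m
  refine ⟨C, fun u ⟨hu, φ, hφ, hφu⟩ => ?_⟩
  rw [tendsto_h1Norm_iff hΩ hb (fun k => (hφ k).1) hu] at hφu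
  have h1 := tendsto_eLpNorm_of_tendsto_sub
    (fun k => memLp_restrict_of_continuous hb (hφ k).1.continuous) hu.1 hφu.1
  have h2 := fun i => tendsto_eLpNorm_of_tendsto_sub
    (fun k => memLp_pderiv hb (hφ k).1) (hu.memLp_weakPartial i) (hφu.2 i)
  exact le_of_tendsto_of_tendsto' h1 (ENNReal.Tendsto.const_mul
    (tendsto_finsetSum Finset.univ fun i _ => h2 i) (Or.inr ENNReal.coe_ne_top))
    fun k => hC _ (hφ k).1 (hφ k).2.1 (hφ k).2.2

/-! ### The minimisation step as an orthogonal projection -/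

/-- The Hilbert space `L²(Ω; ℝᵐ)²` of gradients. -/
abbrev GradSpace (m : ℕ) (Ω : Set (Eucl 2)) : Type :=
  PiLp 2 fun _ : Fin 2 => Lp (Eucl m) 2 (volume.restrict Ω)

/-- The weak gradient of an `H¹` field. -/
def grad {u : Eucl 2 → Eucl m} (hu : MemH1 Ω u) : GradSpace m Ω :=
  WithLp.toLp 2 fun i => (hu.memLp_weakPartial i).toLp

theorem grad_apply {u : Eucl 2 → Eucl m} (hu : MemH1 Ω u) (i : Fin 2) :
    grad hu i = (hu.memLp_weakPartial i).toLp := rfl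

theorem grad_sub (hΩ : IsOpen Ω) {u v : Eucl 2 → Eucl m} (hu : MemH1 Ω u) (hv : MemH1 Ω v) :
    grad (hu.sub hv) = grad hu - grad hv := by
  ext1 i
  rw [PiLp.sub_apply, grad_apply, grad_apply, grad_apply, ← MemLp.toLp_sub]
  exact MemLp.toLp_congr _ _ (weakPartial_sub hΩ hu hv)

theorem grad_smul (hΩ : IsOpen Ω) {u : Eucl 2 → Eucl m} (hu : MemH1 Ω u) (c : ℝ) :
    grad (hu.smul c) = c • grad hu := by
  ext1 i
  rw [PiLp.smul_apply, grad_apply, grad_apply, ← MemLp.toLp_const_smul]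
  exact MemLp.toLp_congr _ _ (weakPartial_smul hΩ hu c)

theorem grad_zero (hΩ : IsOpen Ω) (h : MemH1 Ω (0 : Eucl 2 → Eucl m)) : grad h = 0 := by
  ext1 i
  have hz : weakPartial Ω i (0 : Eucl 2 → Eucl m) =ᵐ[volume.restrict Ω] 0 :=
    weakPartial_ae_eq hΩ MemLp.zero fun φ _ _ _ => by simp
  exact (MemLp.toLp_congr (h.memLp_weakPartial i) MemLp.zero hz).trans (MemLp.toLp_zero _)

theorem norm_toLp_sq_eq_integral {f : Eucl 2 → Eucl m} (hf : MemLp f 2 (volume.restrict Ω)) :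
    ‖hf.toLp‖ ^ 2 = ∫ x in Ω, ‖f x‖ ^ 2 := by
  rw [← real_inner_self_eq_norm_sq, L2.inner_def]
  refine integral_congr_ae ?_
  filter_upwards [hf.coeFn_toLp] with x hx
  rw [hx, real_inner_self_eq_norm_sq]

theorem integrable_weakPartial_sq {u : Eucl 2 → Eucl m} (hu : MemH1 Ω u) (i : Fin 2) :
    Integrable (fun x => ‖weakPartial Ω i u x‖ ^ 2) (volume.restrict Ω) :=
  (memLp_two_iff_integrable_sq_norm (hu.memLp_weakPartial i).1).1 (hu.memLp_weakPartial i)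

theorem energy_eq_norm_grad {u : Eucl 2 → Eucl m} (hu : MemH1 Ω u) :
    energy Ω u = 1 / 2 * ‖grad hu‖ ^ 2 := by
  unfold energy
  rw [integral_finsetSum _ fun i _ => integrable_weakPartial_sq hu i, PiLp.norm_sq_eq_of_L2]
  simp only [grad_apply, norm_toLp_sq_eq_integral]

/-- The **Poincaré inequality** on `H¹₀`, in terms of Hilbert space norms. -/
theorem exists_norm_le_norm_grad (hΩ : IsOpen Ω) (hb : Bornology.IsBounded Ω) (m : ℕ) :
    ∃ C : ℝ, 0 < C ∧ ∀ u : Eucl 2 → Eucl m, ∀ hu : MemH10 Ω u,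
      ‖hu.1.1.toLp‖ ≤ C * ‖grad hu.1‖ := by
  obtain ⟨C, hC⟩ := exists_poincare hΩ hb m
  refine ⟨2 * C + 1, by positivity, fun u hu => ?_⟩
  have h1 : ‖hu.1.1.toLp‖ ≤ C * ∑ i, ‖grad hu.1 i‖ := by
    have h := hC u hu
    simp only [grad_apply, Lp.norm_toLp]
    rw [← ENNReal.toReal_sum fun i _ => (hu.1.memLp_weakPartial i).2.ne]
    have h' := ENNReal.toReal_mono (ENNReal.mul_ne_top ENNReal.coe_ne_top
      (ENNReal.sum_ne_top.2 fun i _ => (hu.1.memLp_weakPartial i).2.ne)) h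
    rwa [ENNReal.toReal_mul, ENNReal.coe_toReal] at h'
  have h2 : ∀ i, ‖grad hu.1 i‖ ≤ ‖grad hu.1‖ := fun i => PiLp.norm_apply_le _ i
  have hC0 : (0 : ℝ) ≤ C := C.2
  rw [Fin.sum_univ_two] at h1
  nlinarith [h2 0, h2 1, norm_nonneg (grad hu.1)]

/-- `H¹₀` is closed in `H¹`. -/
theorem MemH10.of_tendsto (hΩ : IsOpen Ω) (hb : Bornology.IsBounded Ω) {u : Eucl 2 → Eucl m}
    {v : ℕ → Eucl 2 → Eucl m} (hu : MemH1 Ω u) (hv : ∀ k, MemH10 Ω (v k))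
    (h0 : Tendsto (fun k => eLpNorm (v k - u) 2 (volume.restrict Ω)) atTop (𝓝 0))
    (h1 : ∀ i, Tendsto (fun k => eLpNorm (weakPartial Ω i (v k) - weakPartial Ω i u) 2
      (volume.restrict Ω)) atTop (𝓝 0)) : MemH10 Ω u := by
  -- diagonal sequence: a test field within `1 / (k + 1)` of `v k`
  have hpos : ∀ k : ℕ, (0 : ℝ≥0∞) < ((k : ℝ≥0∞) + 1)⁻¹ := fun k => by simp
  have hψ : ∀ k, ∃ ψ : Eucl 2 → Eucl m,
      (ContDiff ℝ ∞ ψ ∧ HasCompactSupport ψ ∧ tsupport ψ ⊆ Ω) ∧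
        h1Norm Ω (ψ - v k) < ((k : ℝ≥0∞) + 1)⁻¹ := fun k => by
    obtain ⟨-, φ, hφ, hφv⟩ := hv k
    obtain ⟨j, hj⟩ := (hφv.eventually (gt_mem_nhds (hpos k))).exists
    exact ⟨φ j, hφ j, hj⟩
  choose ψ hψ hψv using hψ
  have hlim : Tendsto (fun k : ℕ => ((k : ℝ≥0∞) + 1)⁻¹) atTop (𝓝 0) := by
    have := (tendsto_add_atTop_iff_nat 1).2 ENNReal.tendsto_inv_nat_nhds_zero
    simpa using this
  have hd : ∀ k, eLpNorm (ψ k - v k) 2 (volume.restrict Ω) ≤ ((k : ℝ≥0∞) + 1)⁻¹ ∧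
      ∀ i, eLpNorm (pderiv i (ψ k) - weakPartial Ω i (v k)) 2 (volume.restrict Ω) ≤
        ((k : ℝ≥0∞) + 1)⁻¹ := fun k => by
    have h := (hψv k).le
    rw [h1Norm_contDiff_sub hΩ hb (hψ k).1 (hv k).1] at h
    refine ⟨le_self_add.trans h, fun i => le_trans ?_ (le_add_self.trans h)⟩
    exact Finset.single_le_sum (f := fun i =>
      eLpNorm (pderiv i (ψ k) - weakPartial Ω i (v k)) 2 (volume.restrict Ω))
      (fun _ _ => zero_le) (Finset.mem_univ i)
  have htri : ∀ {a b c : Eucl 2 → Eucl m}, AEStronglyMeasurable a (volume.restrict Ω) →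
      AEStronglyMeasurable b (volume.restrict Ω) → AEStronglyMeasurable c (volume.restrict Ω) →
      eLpNorm (a - c) 2 (volume.restrict Ω) ≤ eLpNorm (a - b) 2 (volume.restrict Ω) +
        eLpNorm (b - c) 2 (volume.restrict Ω) := fun ha hb hc => by
    rw [← sub_add_sub_cancel]
    exact eLpNorm_add_le (ha.sub hb) (hb.sub hc) (by norm_num)
  refine ⟨hu, ψ, hψ, (tendsto_h1Norm_iff hΩ hb (fun k => (hψ k).1) hu).2 ⟨?_, fun i => ?_⟩⟩
  · refine tendsto_of_tendsto_of_tendsto_of_le_of_le tendsto_const_nhds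
      (by simpa using hlim.add h0) (fun _ => zero_le) fun k => ?_
    exact (htri (hψ k).1.continuous.aestronglyMeasurable (hv k).1.1.1 hu.1.1).trans
      (add_le_add_left (hd k).1 _)
  · refine tendsto_of_tendsto_of_tendsto_of_le_of_le tendsto_const_nhds
      (by simpa using hlim.add (h1 i)) (fun _ => zero_le) fun k => ?_
    exact (htri (continuous_pderiv (hψ k).1).aestronglyMeasurable
      ((hv k).1.memLp_weakPartial i).1 (hu.memLp_weakPartial i).1).trans
      (add_le_add_left ((hd k).2 i) _)

theorem tangentFields_zero_mem (hΩ : IsOpen Ω) (hb : Bornology.IsBounded Ω)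
    (n : Eucl 2 → Eucl 2) : (0 : Eucl 2 → Eucl 2) ∈ tangentFields Ω n :=
  ⟨memH10_zero hΩ hb, ae_of_all _ fun x => by simp [tangentS]⟩

theorem tangentFields_sub_mem (hΩ : IsOpen Ω) (hb : Bornology.IsBounded Ω)
    {n v w : Eucl 2 → Eucl 2} (hv : v ∈ tangentFields Ω n) (hw : w ∈ tangentFields Ω n) :
    v - w ∈ tangentFields Ω n := by
  refine ⟨hv.1.sub hΩ hb hw.1, ?_⟩
  filter_upwards [hv.2, hw.2] with x h1 h2
  simp only [tangentS, Set.mem_ofPred_eq] at h1 h2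
  simp [tangentS, inner_sub_left, h1, h2]

theorem tangentFields_smul_mem (hΩ : IsOpen Ω) (hb : Bornology.IsBounded Ω)
    {n v : Eucl 2 → Eucl 2} (hv : v ∈ tangentFields Ω n) (c : ℝ) :
    c • v ∈ tangentFields Ω n := by
  refine ⟨hv.1.smul hΩ hb c, ?_⟩
  filter_upwards [hv.2] with x h1
  simp only [tangentS, Set.mem_ofPred_eq] at h1
  simp [tangentS, inner_smul_left, h1]

/-- The gradients of the tangent fields along `n`, as a subspace of `L²`. -/
def tangentGrads (hΩ : IsOpen Ω) (hb : Bornology.IsBounded Ω) (n : Eucl 2 → Eucl 2) :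
    Submodule ℝ (GradSpace 2 Ω) where
  carrier := {y | ∃ v, ∃ hv : v ∈ tangentFields Ω n, grad hv.1.1 = y}
  zero_mem' := ⟨0, tangentFields_zero_mem hΩ hb n, grad_zero hΩ _⟩
  add_mem' := by
    rintro _ _ ⟨v, hv, rfl⟩ ⟨w, hw, rfl⟩
    refine ⟨v - (-1 : ℝ) • w,
      tangentFields_sub_mem hΩ hb hv (tangentFields_smul_mem hΩ hb hw (-1)), ?_⟩
    rw [grad_sub hΩ hv.1.1 (hw.1.1.smul (-1)), grad_smul hΩ hw.1.1]
    simp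
  smul_mem' := by
    rintro c _ ⟨v, hv, rfl⟩
    exact ⟨c • v, tangentFields_smul_mem hΩ hb hv c, grad_smul hΩ hv.1.1 c⟩

/-- By the Poincaré inequality, `L²` convergence of the gradients of tangent fields forces
convergence of the fields, and the limit is again tangent. -/
theorem isClosed_tangentGrads (hΩ : IsOpen Ω) (hb : Bornology.IsBounded Ω)
    (n : Eucl 2 → Eucl 2) : IsClosed (tangentGrads hΩ hb n : Set (GradSpace 2 Ω)) := by
  refine IsSeqClosed.isClosed fun y y₀ hy hlim => ?_
  choose v hv hvy using hy
  obtain ⟨C, hC0, hC⟩ := exists_norm_le_norm_grad hΩ hb 2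
  have hcauchy : CauchySeq fun k => (hv k).1.1.1.toLp := by
    have hyc : CauchySeq y := hlim.cauchySeq
    rw [Metric.cauchySeq_iff] at hyc ⊢
    intro ε hε
    obtain ⟨N, hN⟩ := hyc (ε / C) (by positivity)
    refine ⟨N, fun j hj k hk => ?_⟩
    have h := hC _ ((hv j).1.sub hΩ hb (hv k).1)
    rw [grad_sub hΩ (hv j).1.1 (hv k).1.1, hvy, hvy,
      MemLp.toLp_sub (hv j).1.1.1 (hv k).1.1.1, ← dist_eq_norm, ← dist_eq_norm] at h
    calc _ ≤ C * dist (y j) (y k) := h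
      _ < C * (ε / C) := mul_lt_mul_of_pos_left (hN j hj k hk) hC0
      _ = ε := by field_simp
  obtain ⟨u, hum, hu⟩ : ∃ u, ∃ hum : MemLp u 2 (volume.restrict Ω),
      Tendsto (fun k => (hv k).1.1.1.toLp) atTop (𝓝 hum.toLp) := by
    obtain ⟨U, hU⟩ := cauchySeq_tendsto_of_complete hcauchy
    exact ⟨U, Lp.memLp U, by rwa [Lp.toLp_coeFn]⟩
  obtain ⟨g, hg, hgy⟩ : ∃ g : Fin 2 → Eucl 2 → Eucl 2,
      ∃ hg : ∀ i, MemLp (g i) 2 (volume.restrict Ω), ∀ i, (hg i).toLp = y₀ i :=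
    ⟨fun i => y₀ i, fun i => Lp.memLp _, fun i => Lp.toLp_coeFn _ _⟩
  have h0 : Tendsto (fun k => eLpNorm (v k - u) 2 (volume.restrict Ω)) atTop (𝓝 0) :=
    (Lp.tendsto_Lp_iff_tendsto_eLpNorm'' v (fun k => (hv k).1.1.1) u hum).1 hu
  have h1 : ∀ i, Tendsto (fun k => eLpNorm (weakPartial Ω i (v k) - g i) 2
      (volume.restrict Ω)) atTop (𝓝 0) := fun i => by
    refine (Lp.tendsto_Lp_iff_tendsto_eLpNorm'' _ (fun k => (hv k).1.1.memLp_weakPartial i)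
      (g i) (hg i)).1 ?_
    rw [hgy]
    have : Tendsto (fun k => y k i) atTop (𝓝 (y₀ i)) :=
      ((PiLp.continuous_apply 2 _ i).tendsto y₀).comp hlim
    refine this.congr fun k => ?_
    rw [← hvy k, grad_apply]
  have hw : ∀ i, IsWeakPartial Ω i u (g i) := fun i =>
    IsWeakPartial.of_tendsto hum (hg i) (fun k => (hv k).1.1.1)
      (fun k => (hv k).1.1.memLp_weakPartial i)
      (fun k => (hv k).1.1.isWeakPartial_weakPartial i) h0 (h1 i)
  have huH : MemH1 Ω u := ⟨hum, fun i => ⟨_, hg i, hw i⟩⟩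
  have hwp : ∀ i, weakPartial Ω i u =ᵐ[volume.restrict Ω] g i := fun i =>
    weakPartial_ae_eq hΩ (hg i) (hw i)
  have huH0 : MemH10 Ω u := by
    refine MemH10.of_tendsto hΩ hb huH (fun k => (hv k).1) h0 fun i => ?_
    exact (h1 i).congr fun k => eLpNorm_congr_ae (EventuallyEq.rfl.sub (hwp i).symm)
  refine ⟨u, ⟨huH0, ?_⟩, ?_⟩
  · obtain ⟨ns, -, hae⟩ := (tendstoInMeasure_of_tendsto_eLpNorm (by norm_num)
      (fun k => (hv k).1.1.1.1) hum.1 h0).exists_seq_tendsto_ae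
    filter_upwards [hae, ae_all_iff.2 fun k => (hv k).2] with x hx ht
    have h : Tendsto (fun k => inner ℝ (v (ns k) x) (n x)) atTop (𝓝 (inner ℝ (u x) (n x))) :=
      hx.inner tendsto_const_nhds
    refine tendsto_nhds_unique h (tendsto_const_nhds.congr fun k => ?_)
    exact (ht (ns k)).symm
  · ext1 i
    rw [grad_apply, ← hgy]
    exact MemLp.toLp_congr _ _ (hwp i)

/-- Tangential minimisers are the fields whose gradient is nearest to that of `n`. -/
theorem isTangentMinimizer_iff (hΩ : IsOpen Ω) (hb : Bornology.IsBounded Ω)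
    {n w : Eucl 2 → Eucl 2} (hn : MemH1 Ω n) (hw : w ∈ tangentFields Ω n) :
    IsTangentMinimizer Ω n w ↔
      ‖grad hn - grad hw.1.1‖ = ⨅ y : tangentGrads hΩ hb n, ‖grad hn - y‖ := by
  have hE : ∀ v, ∀ hv : v ∈ tangentFields Ω n,
      energy Ω (n - v) = 1 / 2 * ‖grad hn - grad hv.1.1‖ ^ 2 := fun v hv => by
    rw [energy_eq_norm_grad (hn.sub hv.1.1), grad_sub hΩ]
  have hbdd : BddBelow (Set.range fun y : tangentGrads hΩ hb n => ‖grad hn - y‖) :=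
    ⟨0, by rintro _ ⟨y, rfl⟩; exact norm_nonneg _⟩
  constructor
  · rintro ⟨-, hmin⟩
    refine le_antisymm (le_ciInf ?_) (ciInf_le hbdd ⟨grad hw.1.1, w, hw, rfl⟩)
    rintro ⟨_, v, hv, rfl⟩
    have h : energy Ω (n - w) ≤ energy Ω (n - v) := hmin hv
    rw [hE w hw, hE v hv] at h
    exact le_of_sq_le_sq (by linarith) (norm_nonneg _)
  · intro h
    refine ⟨hw, fun v hv => ?_⟩
    have h1 : ‖grad hn - grad hw.1.1‖ ≤ ‖grad hn - grad hv.1.1‖ :=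
      h.trans_le (ciInf_le hbdd ⟨grad hv.1.1, v, hv, rfl⟩)
    change energy Ω (n - w) ≤ energy Ω (n - v)
    rw [hE w hw, hE v hv]
    gcongr

/-- Existence of the minimiser: projection of the gradient of `n` onto a closed subspace. -/
theorem exists_isTangentMinimizer (hΩ : IsOpen Ω) (hb : Bornology.IsBounded Ω)
    {n : Eucl 2 → Eucl 2} (hn : MemH1 Ω n) : ∃ w, IsTangentMinimizer Ω n w := by
  obtain ⟨_, ⟨w, hw, rfl⟩, h⟩ := (tangentGrads hΩ hb n).exists_norm_eq_iInf_of_complete_subspace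
    (isClosed_tangentGrads hΩ hb n).isComplete (grad hn)
  exact ⟨w, (isTangentMinimizer_iff hΩ hb hn hw).2 h⟩

/-- Uniqueness of the minimiser: the nearest gradient is unique, and by the Poincaré inequality it
determines the field. -/
theorem IsTangentMinimizer.ae_eq (hΩ : IsOpen Ω) (hb : Bornology.IsBounded Ω)
    {n w w' : Eucl 2 → Eucl 2} (hn : MemH1 Ω n) (hw : IsTangentMinimizer Ω n w)
    (hw' : IsTangentMinimizer Ω n w') : w' =ᵐ[volume.restrict Ω] w := by
  have m1 : grad hw.1.1.1 ∈ tangentGrads hΩ hb n := ⟨w, hw.1, rfl⟩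
  have m2 : grad hw'.1.1.1 ∈ tangentGrads hΩ hb n := ⟨w', hw'.1, rfl⟩
  have o1 := ((tangentGrads hΩ hb n).norm_eq_iInf_iff_real_inner_eq_zero m1).1
    ((isTangentMinimizer_iff hΩ hb hn hw.1).1 hw) _ (Submodule.sub_mem _ m2 m1)
  have o2 := ((tangentGrads hΩ hb n).norm_eq_iInf_iff_real_inner_eq_zero m2).1
    ((isTangentMinimizer_iff hΩ hb hn hw'.1).1 hw') _ (Submodule.sub_mem _ m2 m1)
  have hz : grad hw'.1.1.1 - grad hw.1.1.1 = 0 := by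
    rw [← inner_self_eq_zero (𝕜 := ℝ)]
    have : grad hw'.1.1.1 - grad hw.1.1.1 =
        (grad hn - grad hw.1.1.1) - (grad hn - grad hw'.1.1.1) := by abel
    conv_lhs => rw [this, inner_sub_left, ← this]
    rw [o1, o2, sub_zero]
  obtain ⟨C, -, hC⟩ := exists_norm_le_norm_grad hΩ hb 2
  have h := hC _ (hw'.1.1.sub hΩ hb hw.1.1)
  rw [grad_sub hΩ hw'.1.1.1 hw.1.1.1, hz, norm_zero, mul_zero,
    MemLp.toLp_sub hw'.1.1.1.1 hw.1.1.1.1] at h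
  have := sub_eq_zero.1 (norm_le_zero_iff.1 h)
  exact (MemLp.toLp_eq_toLp_iff _ _).1 this

theorem IsTangentMinimizer.congr (hΩ : IsOpen Ω) {n n' w : Eucl 2 → Eucl 2}
    (hn : MemH1 Ω n) (hw : IsTangentMinimizer Ω n w) (h : n =ᵐ[volume.restrict Ω] n') :
    IsTangentMinimizer Ω n' w := by
  have hT : tangentFields Ω n' = tangentFields Ω n := by
    ext v
    refine and_congr_right fun _ => eventually_congr ?_
    filter_upwards [h] with x hx
    rw [hx]
  have hE : ∀ v ∈ tangentFields Ω n, energy Ω (n' - v) = energy Ω (n - v) := fun v hv =>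
    energy_congr hΩ (hn.sub hv.1.1) (h.sub .rfl)
  refine ⟨hT ▸ hw.1, hT ▸ fun v hv => ?_⟩
  change energy Ω (n' - w) ≤ energy Ω (n' - v)
  rw [hE w hw.1, hE v hv]
  exact hw.2 hv

/-! ### The radial projection -/

/-- A smooth map on all of `ℝ²` that agrees with `projS` outside the ball of radius `1 / 2`. -/
def smoothProj (y : Eucl 2) : Eucl 2 :=
  (1 - (⟨1 / 4, 1 / 2, by norm_num, by norm_num⟩ : ContDiffBump (0 : Eucl 2)) y) • projS y

theorem norm_projS_le (y : Eucl 2) : ‖projS y‖ ≤ 1 := by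
  rw [projS, norm_smul, norm_inv, norm_norm]
  exact inv_mul_le_one

theorem norm_projS {y : Eucl 2} (hy : y ≠ 0) : ‖projS y‖ = 1 := by
  rw [projS, norm_smul, norm_inv, norm_norm, inv_mul_cancel₀ (norm_ne_zero_iff.2 hy)]

theorem projS_eq_self {y : Eucl 2} (hy : ‖y‖ = 1) : projS y = y := by simp [projS, hy]

theorem norm_smoothProj_le (y : Eucl 2) : ‖smoothProj y‖ ≤ 1 := by
  rw [smoothProj, norm_smul, Real.norm_eq_abs]
  set b : ContDiffBump (0 : Eucl 2) := ⟨1 / 4, 1 / 2, by norm_num, by norm_num⟩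
  have h : |1 - b y| ≤ 1 := abs_le.2 ⟨by linarith [b.le_one (x := y)], by linarith [b.nonneg' y]⟩
  nlinarith [norm_projS_le y, norm_nonneg (projS y), abs_nonneg (1 - b y)]

theorem smoothProj_eq_projS {y : Eucl 2} (hy : 1 / 2 ≤ ‖y‖) : smoothProj y = projS y := by
  rw [smoothProj, ContDiffBump.zero_of_le_dist _ (by simpa using hy), sub_zero, one_smul]

theorem smoothProj_eventuallyEq {y : Eucl 2} (hy : 1 ≤ ‖y‖) : smoothProj =ᶠ[𝓝 y] projS := by
  have : ∀ᶠ z in 𝓝 y, 1 / 2 < ‖z‖ :=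
    (continuous_norm.tendsto y).eventually (lt_mem_nhds (by linarith))
  exact this.mono fun z hz => smoothProj_eq_projS hz.le

theorem contDiff_smoothProj : ContDiff ℝ ∞ smoothProj := by
  rw [contDiff_iff_contDiffAt]
  intro y
  by_cases hy : y = 0
  · subst hy
    have : smoothProj =ᶠ[𝓝 0] fun _ => 0 := by
      filter_upwards [Metric.closedBall_mem_nhds (0 : Eucl 2) (by norm_num : (0 : ℝ) < 1 / 4)]
        with z hz
      rw [smoothProj, ContDiffBump.one_of_mem_closedBall _ hz, sub_self, zero_smul]
    exact contDiffAt_const.congr_of_eventuallyEq this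
  · unfold smoothProj projS
    exact (contDiffAt_const.sub (ContDiffBump.contDiffAt _)).smul
      (((contDiffAt_norm ℝ hy).inv (norm_ne_zero_iff.2 hy)).smul contDiffAt_id)

/-- Differentiating `‖projS y‖ = 1`: the derivative of the projection is tangential. -/
theorem inner_fderiv_smoothProj {y : Eucl 2} (hy : 1 ≤ ‖y‖) (v : Eucl 2) :
    inner ℝ (fderiv ℝ smoothProj y v) y = 0 := by
  have hy0 : 0 < ‖y‖ := by linarith
  have hd : HasFDerivAt smoothProj (fderiv ℝ smoothProj y) y :=
    (contDiff_smoothProj.differentiable (by simp) y).hasFDerivAt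
  have h1 := hd.norm_sq
  have h2 : (fun z => ‖smoothProj z‖ ^ 2) =ᶠ[𝓝 y] fun _ => 1 := by
    filter_upwards [smoothProj_eventuallyEq hy,
      isOpen_ne.mem_nhds (norm_pos_iff.1 hy0)] with z hz hz0
    rw [hz, norm_projS hz0, one_pow]
  have h3 := DFunLike.congr_fun
    (h1.unique ((hasFDerivAt_const (1 : ℝ) y).congr_of_eventuallyEq h2)) v
  have h4 : inner ℝ (smoothProj y) (fderiv ℝ smoothProj y v) = 0 := by
    simpa using h3
  rw [(smoothProj_eventuallyEq hy).self_of_nhds, projS, inner_smul_left] at h4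
  rw [real_inner_comm]
  simpa [hy0.ne'] using h4

/-- Outside the unit ball the radial projection contracts: `‖y‖⁻¹ v` splits orthogonally into the
derivative in direction `v` and a multiple of `y`. -/
theorem norm_fderiv_smoothProj_apply_le {y : Eucl 2} (hy : 1 ≤ ‖y‖) (v : Eucl 2) :
    ‖fderiv ℝ smoothProj y v‖ ≤ ‖v‖ := by
  have hy0 : 0 < ‖y‖ := by linarith
  have hN : DifferentiableAt ℝ (fun z : Eucl 2 => ‖z‖⁻¹) y :=
    ((contDiffAt_norm ℝ (norm_pos_iff.1 hy0)).inv hy0.ne' :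
      ContDiffAt ℝ 1 _ y).differentiableAt (by simp)
  obtain ⟨a, ha⟩ : ∃ a : ℝ, fderiv ℝ smoothProj y v = ‖y‖⁻¹ • v + a • y := by
    refine ⟨fderiv ℝ (fun z : Eucl 2 => ‖z‖⁻¹) y v, ?_⟩
    rw [(smoothProj_eventuallyEq hy).fderiv_eq]
    have := hN.hasFDerivAt.smul (hasFDerivAt_id y)
    have h : fderiv ℝ projS y = _ := this.fderiv
    rw [h]
    simp
  have ho := inner_fderiv_smoothProj hy v
  set d := fderiv ℝ smoothProj y v
  have hv : ‖y‖⁻¹ • v = d + (-a) • y := by rw [ha]; simp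
  have hsq : ‖‖y‖⁻¹ • v‖ ^ 2 = ‖d‖ ^ 2 + ‖(-a) • y‖ ^ 2 := by
    rw [hv, norm_add_sq_real, inner_smul_right, ho]
    ring
  have h1 : ‖d‖ ≤ ‖‖y‖⁻¹ • v‖ :=
    le_of_sq_le_sq (by rw [hsq]; linarith [sq_nonneg ‖(-a) • y‖]) (norm_nonneg _)
  refine h1.trans ?_
  rw [norm_smul, norm_inv, norm_norm]
  exact mul_le_of_le_one_left (norm_nonneg _) (inv_le_one_of_one_le₀ hy)

theorem exists_norm_fderiv_smoothProj_le : ∃ C : ℝ, ∀ y, ‖fderiv ℝ smoothProj y‖ ≤ C := by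
  have hc : Continuous (fderiv ℝ smoothProj) := contDiff_smoothProj.continuous_fderiv (by simp)
  obtain ⟨C, hC⟩ := ((isCompact_closedBall (0 : Eucl 2) 1).image hc).isBounded.exists_norm_le
  refine ⟨max C 1, fun y => ?_⟩
  rcases le_total ‖y‖ 1 with h | h
  · exact (hC _ (Set.mem_image_of_mem _ (by simpa using h))).trans (le_max_left _ _)
  · refine (ContinuousLinearMap.opNorm_le_bound _ zero_le_one fun v => ?_).trans (le_max_right _ _)
    simpa using norm_fderiv_smoothProj_apply_le h v

/-! ### The map `𝒢` -/

theorem mapG_eq (n : Eucl 2) : mapG Qc Mc n =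
    !₂[Qc * (2 * n 0 ^ 2 - 1), Qc * (2 * n 1 * n 0), Mc * n 0, Mc * n 1] := by
  have h0 : mapR n 0 = 2 * n 0 ^ 2 - 1 := by
    simp [mapR, Matrix.vecMulVec_apply]
    ring
  have h1 : mapR n 1 = 2 * n 1 * n 0 := by
    simp [mapR, Matrix.vecMulVec_apply]
    ring
  rw [mapG, h0, h1]

theorem contDiff_mapG : ContDiff ℝ ∞ (mapG Qc Mc) := by
  rw [contDiff_euclidean]
  intro j
  fin_cases j <;> simp only [mapG_eq] <;> simp <;> fun_prop

theorem fderiv_mapG (p v : Eucl 2) : fderiv ℝ (mapG Qc Mc) p v =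
    !₂[Qc * (4 * p 0 * v 0), Qc * (2 * (v 1 * p 0 + p 1 * v 0)), Mc * v 0, Mc * v 1] := by
  have hd : HasFDerivAt (mapG Qc Mc) (fderiv ℝ (mapG Qc Mc) p) p :=
    (contDiff_mapG.differentiable (by simp) p).hasFDerivAt
  -- `mapG` is quadratic, hence a polynomial of degree two along lines
  set A : Eucl 4 :=
    !₂[Qc * (4 * p 0 * v 0), Qc * (2 * (v 1 * p 0 + p 1 * v 0)), Mc * v 0, Mc * v 1] with hA
  set B : Eucl 4 := !₂[Qc * (2 * v 0 ^ 2), Qc * (2 * v 1 * v 0), 0, 0] with hB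
  have h : ∀ t : ℝ, mapG Qc Mc (p + t • v) = mapG Qc Mc p + t • A + t ^ 2 • B := by
    intro t
    ext j
    fin_cases j <;> simp [mapG_eq, hA, hB] <;> ring
  have h' : HasLineDerivAt ℝ (mapG Qc Mc) A p v := by
    unfold HasLineDerivAt
    simp only [h]
    have h1 : HasDerivAt (fun t : ℝ => t • A) ((1 : ℝ) • A) 0 := (hasDerivAt_id 0).smul_const A
    have h2 : HasDerivAt (fun t : ℝ => t ^ 2 • B) ((0 : ℝ) • B) 0 := by
      simpa using ((hasDerivAt_id (0 : ℝ)).pow 2).smul_const B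
    have h3 := (h1.const_add (mapG Qc Mc p)).add h2
    rw [one_smul, zero_smul, add_zero] at h3
    exact h3
  exact (hd.hasLineDerivAt v).unique h'

/-- On tangent vectors of the circle `𝒢` is a similarity, with ratio independent of the point. -/
theorem norm_sq_fderiv_mapG {p v : Eucl 2} (hp : ‖p‖ = 1) (hv : inner ℝ v p = 0) :
    ‖fderiv ℝ (mapG Qc Mc) p v‖ ^ 2 = (4 * Qc ^ 2 + Mc ^ 2) * ‖v‖ ^ 2 := by
  have hp' : p 0 ^ 2 + p 1 ^ 2 = 1 := by
    have := EuclideanSpace.real_norm_sq_eq p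
    rw [hp, Fin.sum_univ_two] at this
    linarith
  have hv' : v 0 * p 0 + v 1 * p 1 = 0 := by
    rw [PiLp.inner_apply, Fin.sum_univ_two] at hv
    simp only [RCLike.inner_apply, conj_trivial] at hv
    linarith
  rw [fderiv_mapG, EuclideanSpace.real_norm_sq_eq, EuclideanSpace.real_norm_sq_eq,
    Fin.sum_univ_two, Fin.sum_univ_four]
  simp only [Matrix.cons_val]
  -- tangency gives `p 0 * v 0 = - p 1 * v 1`; then the two quadratic components are the real and
  -- imaginary part of `2 (p 0 + i p 1) (v 0 + i v 1)`
  have e : 4 * p 0 * v 0 = 2 * (p 0 * v 0 - p 1 * v 1) := by linear_combination 2 * hv'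
  rw [e]
  linear_combination 4 * Qc ^ 2 * (v 0 ^ 2 + v 1 ^ 2) * hp'

/-- The linear map of `ℝ⁴` to `ℝ²` that inverts `𝒢` on `𝒩`. -/
def lowerG (Mc : ℝ) : Eucl 4 →L[ℝ] Eucl 2 :=
  LinearMap.toContinuousLinearMap
    { toFun := fun y => !₂[Mc⁻¹ * y 2, Mc⁻¹ * y 3]
      map_add' := fun x y => by ext j; fin_cases j <;> simp [mul_add]
      map_smul' := fun c y => by ext j; fin_cases j <;> simp <;> ring }

theorem lowerG_mapG (hMc : 0 < Mc) (n : Eucl 2) : lowerG Mc (mapG Qc Mc n) = n := by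
  ext j
  fin_cases j <;> simp [lowerG, mapG_eq, hMc.ne']

theorem invG_mapG (hMc : 0 < Mc) {n : Eucl 2} (hn : n ∈ circleS) :
    invG Qc Mc (mapG Qc Mc n) = n := by
  have hinj : Set.InjOn (mapG Qc Mc) circleS := fun a _ b _ h => by
    rw [← lowerG_mapG (Qc := Qc) hMc a, h, lowerG_mapG hMc]
  exact hinj.leftInvOn_invFunOn hn

theorem mapG_lowerG (hMc : 0 < Mc) {y : Eucl 4} (hy : y ∈ manifoldN Qc Mc) :
    mapG Qc Mc (lowerG Mc y) = y := by
  obtain ⟨p, -, rfl⟩ := hy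
  rw [lowerG_mapG hMc]

theorem lowerG_mem (hMc : 0 < Mc) {y : Eucl 4} (hy : y ∈ manifoldN Qc Mc) :
    lowerG Mc y ∈ circleS := by
  obtain ⟨p, hp, rfl⟩ := hy
  rwa [lowerG_mapG hMc]

/-- On `𝒩` the inverse of `𝒢` is linear, so the pull-back of an `H¹` field is an `H¹` field. -/
theorem invG_eq_lowerG (hMc : 0 < Mc) {y : Eucl 4} (hy : y ∈ manifoldN Qc Mc) :
    invG Qc Mc y = lowerG Mc y := by
  obtain ⟨p, hp, rfl⟩ := hy
  rw [lowerG_mapG hMc, invG_mapG hMc hp]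

/-! ### Projecting onto the circle and lifting to `𝒩` -/

/-- A smooth map on `ℝ²` with bounded derivative that agrees with `𝒢 ∘ P_S` off a small ball. -/
def liftG (Qc Mc : ℝ) : Eucl 2 → Eucl 4 := mapG Qc Mc ∘ smoothProj

theorem liftG_eq {y : Eucl 2} (hy : 1 ≤ ‖y‖) : liftG Qc Mc y = mapG Qc Mc (projS y) := by
  rw [liftG, Function.comp_apply, smoothProj_eq_projS (by linarith)]

theorem contDiff_liftG : ContDiff ℝ ∞ (liftG Qc Mc) := contDiff_mapG.comp contDiff_smoothProj

theorem fderiv_liftG (y v : Eucl 2) : fderiv ℝ (liftG Qc Mc) y v =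
    fderiv ℝ (mapG Qc Mc) (smoothProj y) (fderiv ℝ smoothProj y v) := by
  rw [liftG, fderiv_comp y (contDiff_mapG.differentiable (by simp) _)
    (contDiff_smoothProj.differentiable (by simp) _)]
  rfl

theorem exists_norm_fderiv_liftG_le (Qc Mc : ℝ) :
    ∃ C : ℝ, ∀ y, ‖fderiv ℝ (liftG Qc Mc) y‖ ≤ C := by
  have hc : Continuous (fderiv ℝ (mapG Qc Mc)) := contDiff_mapG.continuous_fderiv (by simp)
  obtain ⟨C, hC⟩ := ((isCompact_closedBall (0 : Eucl 2) 1).image hc).isBounded.exists_norm_le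
  obtain ⟨C', hC'⟩ := exists_norm_fderiv_smoothProj_le
  have hC0 : 0 ≤ C := (norm_nonneg _).trans
    (hC _ (Set.mem_image_of_mem _ (Metric.mem_closedBall_self zero_le_one)))
  refine ⟨C * C', fun y => ?_⟩
  rw [liftG, fderiv_comp y (contDiff_mapG.differentiable (by simp) _)
    (contDiff_smoothProj.differentiable (by simp) _)]
  exact (ContinuousLinearMap.opNorm_comp_le _ _).trans (mul_le_mul
    (hC _ (Set.mem_image_of_mem _ (by simpa using norm_smoothProj_le y))) (hC' y)
    (norm_nonneg _) hC0)

theorem norm_sq_fderiv_liftG {y : Eucl 2} (hy : 1 ≤ ‖y‖) (v : Eucl 2) :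
    ‖fderiv ℝ (liftG Qc Mc) y v‖ ^ 2 =
      (4 * Qc ^ 2 + Mc ^ 2) * ‖fderiv ℝ smoothProj y v‖ ^ 2 := by
  have hy0 : y ≠ 0 := norm_pos_iff.1 (by linarith)
  rw [fderiv_liftG, smoothProj_eq_projS (by linarith)]
  refine norm_sq_fderiv_mapG (norm_projS hy0) ?_
  rw [projS, inner_smul_right, inner_fderiv_smoothProj hy, mul_zero]

/-! ### One step of the iteration -/

theorem energy_mono_of_norm_sq_le {m' : ℕ} {u : Eucl 2 → Eucl m} {v : Eucl 2 → Eucl m'}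
    (hu : MemH1 Ω u) (hv : MemH1 Ω v) {c : ℝ}
    (h : ∀ i, ∀ᵐ x ∂(volume.restrict Ω),
      ‖weakPartial Ω i u x‖ ^ 2 ≤ c * ‖weakPartial Ω i v x‖ ^ 2) :
    energy Ω u ≤ c * energy Ω v := by
  unfold energy
  rw [mul_left_comm, ← integral_const_mul c]
  refine mul_le_mul_of_nonneg_left (integral_mono_ae
    (integrable_finsetSum _ fun i _ => integrable_weakPartial_sq hu i)
    ((integrable_finsetSum _ fun i _ => integrable_weakPartial_sq hv i).const_mul c) ?_)
    (by norm_num : (0 : ℝ) ≤ 1 / 2)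
  filter_upwards [ae_all_iff.2 h] with x hx
  rw [Finset.mul_sum]
  exact Finset.sum_le_sum fun i _ => hx i

/-- Projecting a field of length at least one to the circle and lifting it to `𝒩` does not
increase the energy, up to the factor `4 Q_c² + M_c²`. -/
theorem energy_liftG_le (hΩ : IsOpen Ω) (hb : Bornology.IsBounded Ω) {u : Eucl 2 → Eucl 2}
    (hu : MemH1 Ω u) (hu1 : ∀ᵐ x ∂(volume.restrict Ω), 1 ≤ ‖u x‖) {φ : ℕ → Eucl 2 → Eucl 2}
    (hφ : ∀ k, ContDiff ℝ ∞ (φ k)) (hφu : Tendsto (fun k => h1Norm Ω (φ k - u)) atTop (𝓝 0)) :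
    energy Ω (liftG Qc Mc ∘ u) ≤ (4 * Qc ^ 2 + Mc ^ 2) * energy Ω u := by
  obtain ⟨C, hC⟩ := exists_norm_fderiv_liftG_le Qc Mc
  obtain ⟨h1, h2, -⟩ := chain_rule hΩ hb contDiff_liftG hC hu hφ hφu
  refine energy_mono_of_norm_sq_le h1 hu fun i => ?_
  filter_upwards [h2 i, hu1] with x hx hx1
  rw [hx, norm_sq_fderiv_liftG hx1]
  have := norm_fderiv_smoothProj_apply_le hx1 (weakPartial Ω i u x)
  gcongr

/-- For a unit field the bound of `energy_liftG_le` is attained: since `u = P_S ∘ u`, the chain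
rule shows that the derivatives of `u` are tangential, and there `𝒢` is a similarity. -/
theorem energy_le_energy_liftG (hΩ : IsOpen Ω) (hb : Bornology.IsBounded Ω) {u : Eucl 2 → Eucl 2}
    (hu : MemH1 Ω u) (hu1 : ∀ᵐ x ∂(volume.restrict Ω), ‖u x‖ = 1) {φ : ℕ → Eucl 2 → Eucl 2}
    (hφ : ∀ k, ContDiff ℝ ∞ (φ k)) (hφu : Tendsto (fun k => h1Norm Ω (φ k - u)) atTop (𝓝 0))
    (hM : 0 < Mc) :
    (4 * Qc ^ 2 + Mc ^ 2) * energy Ω u ≤ energy Ω (liftG Qc Mc ∘ u) := by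
  obtain ⟨C, hC⟩ := exists_norm_fderiv_liftG_le Qc Mc
  obtain ⟨h1, h2, -⟩ := chain_rule hΩ hb contDiff_liftG hC hu hφ hφu
  obtain ⟨C', hC'⟩ := exists_norm_fderiv_smoothProj_le
  obtain ⟨-, h4, -⟩ := chain_rule hΩ hb contDiff_smoothProj hC' hu hφ hφu
  have hself : u =ᵐ[volume.restrict Ω] smoothProj ∘ u := by
    filter_upwards [hu1] with x hx
    rw [Function.comp_apply, smoothProj_eq_projS (by rw [hx]; norm_num), projS_eq_self hx]
  have hc : 0 < 4 * Qc ^ 2 + Mc ^ 2 := by positivity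
  rw [← le_inv_mul_iff₀ hc]
  refine energy_mono_of_norm_sq_le hu h1 fun i => ?_
  filter_upwards [h2 i, h4 i, hu.weakPartial_congr (i := i) hΩ hself, hu1] with x hx hx' hx'' hx1
  rw [hx, norm_sq_fderiv_liftG hx1.ge, inv_mul_cancel_left₀ hc.ne', ← hx', hx'']

/-- Pulling an admissible field back to the circle. -/
theorem admissible_pull_back (hΩ : IsOpen Ω) (hb : Bornology.IsBounded Ω) (hMc : 0 < Mc)
    {Ψb Ψ : Eucl 2 → Eucl 4} (hΨ : Ψ ∈ admissible Qc Mc Ω Ψb) {n : Eucl 2 → Eucl 2}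
    (hn : n =ᵐ[volume.restrict Ω] fun x => invG Qc Mc (Ψ x)) :
    MemH1 Ω n ∧ (∀ᵐ x ∂(volume.restrict Ω), n x ∈ circleS) ∧
      (Ψ =ᵐ[volume.restrict Ω] fun x => mapG Qc Mc (n x)) ∧
      ∃ φ : ℕ → Eucl 2 → Eucl 2, (∀ k, ContDiff ℝ ∞ (φ k)) ∧
        Tendsto (fun k => h1Norm Ω (φ k - n)) atTop (𝓝 0) ∧
        Tendsto (fun k => eLpNorm (φ k - lowerG Mc ∘ Ψb) 2 (boundaryMeasure Ω)) atTop (𝓝 0) := by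
  obtain ⟨hH, hN, -, -, φ, hφ, hφΨ, hφb⟩ := hΨ
  have hnL : lowerG Mc ∘ Ψ =ᵐ[volume.restrict Ω] n := by
    filter_upwards [hn, hN] with x h1 h2
    rw [h1, invG_eq_lowerG hMc h2, Function.comp_apply]
  obtain ⟨h1, -, ns, hns, h3⟩ := chain_rule hΩ hb (F := lowerG Mc) (lowerG Mc).contDiff
    (C := ‖lowerG Mc‖) (fun y => by rw [ContinuousLinearMap.fderiv]) hH hφ hφΨ
  have hs : ∀ k, ContDiff ℝ ∞ (lowerG Mc ∘ φ (ns k)) := fun k =>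
    (lowerG Mc).contDiff.comp (hφ (ns k))
  refine ⟨h1.congr hnL, ?_, ?_, fun k => lowerG Mc ∘ φ (ns k), hs, ?_, ?_⟩
  · filter_upwards [hnL, hN] with x h4 h5
    rw [← h4]
    exact lowerG_mem hMc h5
  · filter_upwards [hnL, hN] with x h4 h5
    rw [← h4, Function.comp_apply, mapG_lowerG hMc h5]
  · refine h3.congr fun k => h1Norm_congr hΩ ((h1.congr hnL |> (memH1_of_contDiff hb (hs k)).sub))
      (EventuallyEq.rfl.sub hnL.symm)
  · refine tendsto_eLpNorm_of_le_mul (C := ‖lowerG Mc‖) (fun k => ae_of_all _ fun x => ?_)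
      (hφb.comp hns.tendsto_atTop)
    simp only [Pi.sub_apply, Function.comp_apply]
    rw [← map_sub]
    exact (lowerG Mc).le_opNorm _

theorem one_le_norm_sub_of_tangent {n w : Eucl 2} (hn : n ∈ circleS) (hw : w ∈ tangentS n) :
    1 ≤ ‖n - w‖ := by
  have h1 : ‖n‖ = 1 := by simpa [circleS] using hn
  have h2 : inner ℝ n w = 0 := by rw [real_inner_comm]; exact hw
  have h3 := norm_sub_sq_real n w
  rw [h1, h2] at h3
  nlinarith [norm_nonneg (n - w), sq_nonneg ‖w‖]

/-- One step of the iteration stays admissible and does not increase the energy. With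
`κ = 4 Q_c² + M_c²` the energies satisfy `E(Ψ') ≤ κ E(n - w) ≤ κ E(n) ≤ E(Ψ)`; the middle
inequality compares the minimiser with the field `0`. -/
theorem iteration_step (hΩ : IsOpen Ω) (hb : Bornology.IsBounded Ω) (hMc : 0 < Mc)
    {Ψb Ψ Ψ' : Eucl 2 → Eucl 4} {n w : Eucl 2 → Eucl 2}
    (hΨbN : ∀ᵐ x ∂(boundaryMeasure Ω), Ψb x ∈ manifoldN Qc Mc)
    (hΨ : Ψ ∈ admissible Qc Mc Ω Ψb) (hn : n =ᵐ[volume.restrict Ω] fun x => invG Qc Mc (Ψ x))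
    (hw : IsTangentMinimizer Ω n w)
    (hΨ' : Ψ' =ᵐ[volume.restrict Ω] fun x => mapG Qc Mc (projS (n x - w x))) :
    (∀ᵐ x ∂(volume.restrict Ω), 1 ≤ ‖n x - w x‖) ∧ Ψ' ∈ admissible Qc Mc Ω Ψb ∧
      energy Ω Ψ' ≤ energy Ω Ψ := by
  obtain ⟨hnH, hnS, hΨn, φ, hφ, hφn, hφb⟩ := admissible_pull_back hΩ hb hMc hΨ hn
  obtain ⟨⟨⟨hwH, η, hη, hηw⟩, hwt⟩, hmin⟩ := id hw
  have hge : ∀ᵐ x ∂(volume.restrict Ω), 1 ≤ ‖n x - w x‖ := by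
    filter_upwards [hnS, hwt] with x h1 h2
    exact one_le_norm_sub_of_tangent h1 h2
  have hu : MemH1 Ω (n - w) := hnH.sub hwH
  have hs : ∀ k, ContDiff ℝ ∞ (φ k - η k) := fun k => (hφ k).sub (hη k).1
  have hsu := tendsto_h1Norm_sub_sub hΩ hb hφ (fun k => (hη k).1) hnH hwH hφn hηw
  obtain ⟨C, hC⟩ := exists_norm_fderiv_liftG_le Qc Mc
  obtain ⟨h1, -, ns, hns, h3⟩ := chain_rule hΩ hb contDiff_liftG hC hu hs hsu
  have hlift : liftG Qc Mc ∘ (n - w) =ᵐ[volume.restrict Ω] Ψ' := by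
    filter_upwards [hΨ', hge] with x h4 h5
    rw [h4, Function.comp_apply, Pi.sub_apply, liftG_eq h5]
  have hH' : MemH1 Ω Ψ' := h1.congr hlift
  have hs' : ∀ k, ContDiff ℝ ∞ (liftG Qc Mc ∘ (φ (ns k) - η (ns k))) := fun k =>
    contDiff_liftG.comp (hs (ns k))
  refine ⟨hge, ⟨hH', ?_, hH', hΨ.2.2.2.1, _, hs', ?_, ?_⟩, ?_⟩
  · filter_upwards [hΨ', hge] with x h4 h5
    rw [h4]
    refine ⟨_, ?_, rfl⟩
    simp [circleS, norm_projS (norm_pos_iff.1 (lt_of_lt_of_le one_pos h5))]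
  · exact h3.congr fun k => h1Norm_congr hΩ ((memH1_of_contDiff hb (hs' k)).sub hH')
      (EventuallyEq.rfl.sub hlift.symm)
  · -- the test fields vanish on the boundary, and `liftG` recovers the boundary values
    refine tendsto_eLpNorm_of_le_mul (C := C) (fun k => ?_) (hφb.comp hns.tendsto_atTop)
    have hmem : ∀ᵐ x ∂(boundaryMeasure Ω), x ∈ frontier Ω :=
      ae_restrict_mem isClosed_frontier.measurableSet
    filter_upwards [hmem, hΨbN] with x hx hxN
    have hη0 : η (ns k) x = 0 := image_eq_zero_of_notMem_tsupport fun h => by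
      rw [hΩ.frontier_eq] at hx
      exact hx.2 ((hη (ns k)).2.2 h)
    have hS : ‖lowerG Mc (Ψb x)‖ = 1 := by simpa [circleS] using lowerG_mem hMc hxN
    have hb' : liftG Qc Mc (lowerG Mc (Ψb x)) = Ψb x := by
      rw [liftG_eq hS.ge, projS_eq_self hS, mapG_lowerG hMc hxN]
    have := norm_sub_le_of_fderiv_bound contDiff_liftG hC (φ (ns k) x) (lowerG Mc (Ψb x))
    rw [hb'] at this
    simpa [hη0] using this
  · have hn1 : ∀ᵐ x ∂(volume.restrict Ω), ‖n x‖ = 1 := by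
      filter_upwards [hnS] with x hx
      simpa [circleS] using hx
    have hliftn : liftG Qc Mc ∘ n =ᵐ[volume.restrict Ω] Ψ := by
      filter_upwards [hΨn, hn1] with x h4 h5
      rw [h4, Function.comp_apply, liftG_eq h5.ge, projS_eq_self h5]
    obtain ⟨h6, -⟩ := chain_rule hΩ hb contDiff_liftG hC hnH hφ hφn
    have h0 : energy Ω (n - w) ≤ energy Ω n := by
      have h : energy Ω (n - w) ≤ energy Ω (n - 0) := hmin (tangentFields_zero_mem hΩ hb n)
      rwa [sub_zero] at h
    calc energy Ω Ψ' = energy Ω (liftG Qc Mc ∘ (n - w)) := energy_congr hΩ h1 hlift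
      _ ≤ (4 * Qc ^ 2 + Mc ^ 2) * energy Ω (n - w) :=
          energy_liftG_le hΩ hb hu hge hs hsu
      _ ≤ (4 * Qc ^ 2 + Mc ^ 2) * energy Ω n := by gcongr
      _ ≤ energy Ω (liftG Qc Mc ∘ n) := energy_le_energy_liftG hΩ hb hnH hn1 hφ hφn hMc
      _ = energy Ω Ψ := (energy_congr hΩ h6 hliftn).symm

/-! ### The iteration -/

theorem IsIteration.push_forward_eq {Ψ : ℕ → Eucl 2 → Eucl 4} {n w : ℕ → Eucl 2 → Eucl 2}
    (h : IsIteration Qc Mc Ω Ψ n w) (j : ℕ) :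
    Ψ (j + 1) =ᵐ[volume.restrict Ω] fun x => mapG Qc Mc (projS (n j x - w j x)) := by
  filter_upwards [h.push_forward j, h.project j] with x h1 h2
  rw [h1, h2]

theorem IsIteration.mem_admissible (hΩ : IsOpen Ω) (hb : Bornology.IsBounded Ω) (hMc : 0 < Mc)
    {Ψb : Eucl 2 → Eucl 4} (hΨbN : ∀ᵐ x ∂(boundaryMeasure Ω), Ψb x ∈ manifoldN Qc Mc)
    {Ψ : ℕ → Eucl 2 → Eucl 4} {n w : ℕ → Eucl 2 → Eucl 2}
    (h0 : Ψ 0 ∈ admissible Qc Mc Ω Ψb) (h : IsIteration Qc Mc Ω Ψ n w) (j : ℕ) :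
    Ψ j ∈ admissible Qc Mc Ω Ψb := by
  induction j with
  | zero => exact h0
  | succ j ih => exact (iteration_step hΩ hb hMc hΨbN ih (h.pull_back j) (h.minimise j)
      (h.push_forward_eq j)).2.1

theorem exists_isIteration (hΩ : IsOpen Ω) (hb : Bornology.IsBounded Ω) (hMc : 0 < Mc)
    {Ψb : Eucl 2 → Eucl 4} (hΨbN : ∀ᵐ x ∂(boundaryMeasure Ω), Ψb x ∈ manifoldN Qc Mc)
    {Ψ₀ : Eucl 2 → Eucl 4} (h0 : Ψ₀ ∈ admissible Qc Mc Ω Ψb) :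
    ∃ (Ψ : ℕ → Eucl 2 → Eucl 4) (n w : ℕ → Eucl 2 → Eucl 2),
      Ψ 0 = Ψ₀ ∧ IsIteration Qc Mc Ω Ψ n w := by
  have hw : ∀ Φ : admissible Qc Mc Ω Ψb, ∃ w,
      IsTangentMinimizer Ω (fun x => invG Qc Mc (Φ.1 x)) w := fun Φ =>
    exists_isTangentMinimizer hΩ hb (admissible_pull_back hΩ hb hMc Φ.2 .rfl).1
  choose W hW using hw
  let step : admissible Qc Mc Ω Ψb → admissible Qc Mc Ω Ψb := fun Φ =>
    ⟨fun x => mapG Qc Mc (projS (invG Qc Mc (Φ.1 x) - W Φ x)),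
      (iteration_step hΩ hb hMc hΨbN Φ.2 .rfl (hW Φ) .rfl).2.1⟩
  let S : ℕ → admissible Qc Mc Ω Ψb := fun j => step^[j] ⟨Ψ₀, h0⟩
  have hS : ∀ j, S (j + 1) = step (S j) := fun j => Function.iterate_succ_apply' _ _ _
  have hp : ∀ j, (fun x => invG Qc Mc ((S (j + 1)).1 x)) =ᵐ[volume.restrict Ω]
      fun x => projS (invG Qc Mc ((S j).1 x) - W (S j) x) := fun j => by
    filter_upwards [(iteration_step hΩ hb hMc hΨbN (S j).2 .rfl (hW (S j)) .rfl).1] with x hx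
    rw [hS]
    refine invG_mapG hMc ?_
    simp [circleS, norm_projS (norm_pos_iff.1 (lt_of_lt_of_le one_pos hx))]
  refine ⟨fun j => (S j).1, fun j x => invG Qc Mc ((S j).1 x), fun j => W (S j), rfl,
    fun j => .rfl, fun j => hW (S j), hp, fun j => ?_⟩
  filter_upwards [hp j] with x hx
  rw [hx, hS]

theorem IsIteration.ae_eq (hΩ : IsOpen Ω) (hb : Bornology.IsBounded Ω) (hMc : 0 < Mc)
    {Ψb : Eucl 2 → Eucl 4} (hΨbN : ∀ᵐ x ∂(boundaryMeasure Ω), Ψb x ∈ manifoldN Qc Mc)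
    {Ψ Ψ' : ℕ → Eucl 2 → Eucl 4} {n w n' w' : ℕ → Eucl 2 → Eucl 2}
    (h0 : Ψ 0 ∈ admissible Qc Mc Ω Ψb) (h0' : Ψ' 0 =ᵐ[volume.restrict Ω] Ψ 0)
    (h : IsIteration Qc Mc Ω Ψ n w) (h' : IsIteration Qc Mc Ω Ψ' n' w') (j : ℕ) :
    n' j =ᵐ[volume.restrict Ω] n j ∧ w' j =ᵐ[volume.restrict Ω] w j ∧
      Ψ' j =ᵐ[volume.restrict Ω] Ψ j := by
  have key : ∀ j, Ψ' j =ᵐ[volume.restrict Ω] Ψ j →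
      n' j =ᵐ[volume.restrict Ω] n j ∧ w' j =ᵐ[volume.restrict Ω] w j := fun j hj => by
    have hn : n' j =ᵐ[volume.restrict Ω] n j := by
      filter_upwards [hj, h.pull_back j, h'.pull_back j] with x h1 h2 h3
      rw [h2, h3, h1]
    have hnH := (admissible_pull_back hΩ hb hMc (h.mem_admissible hΩ hb hMc hΨbN h0 j)
      (h.pull_back j)).1
    exact ⟨hn, (h.minimise j).ae_eq hΩ hb hnH
      ((h'.minimise j).congr hΩ (hnH.congr hn.symm) hn)⟩
  have hΨ : ∀ j, Ψ' j =ᵐ[volume.restrict Ω] Ψ j := fun j => by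
    induction j with
    | zero => exact h0'
    | succ j ih =>
      filter_upwards [h.push_forward_eq j, h'.push_forward_eq j, (key j ih).1, (key j ih).2]
        with x h1 h2 h3 h4
      rw [h1, h2, h3, h4]
  exact ⟨(key j (hΨ j)).1, (key j (hΨ j)).2, hΨ j⟩

end Ferronematic

end

theorem mainTheorem1 (Qc Mc : ℝ) (hQc : 0 < Qc) (hMc : 0 < Mc)
    (Ω : Set (Ferronematic.Eucl 2)) (hΩ : Ferronematic.IsLipschitzDomain Ω)
    (Ψb : Ferronematic.Eucl 2 → Ferronematic.Eucl 4)
    (hΨb : Ferronematic.MemHHalf Ω Ψb)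
    (hΨbN : ∀ᵐ x ∂(Ferronematic.boundaryMeasure Ω), Ψb x ∈ Ferronematic.manifoldN Qc Mc) :
    -- the iteration can be carried out from every initial field in `W`
    (∀ Ψ₀ ∈ Ferronematic.admissible Qc Mc Ω Ψb,
      ∃ (Ψ : ℕ → Ferronematic.Eucl 2 → Ferronematic.Eucl 4)
        (n w : ℕ → Ferronematic.Eucl 2 → Ferronematic.Eucl 2),
        Ψ 0 = Ψ₀ ∧ Ferronematic.IsIteration Qc Mc Ω Ψ n w) ∧
    -- its result is determined (almost everywhere) by the initial field
    (∀ (Ψ Ψ' : ℕ → Ferronematic.Eucl 2 → Ferronematic.Eucl 4)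
      (n w n' w' : ℕ → Ferronematic.Eucl 2 → Ferronematic.Eucl 2),
      Ψ 0 ∈ Ferronematic.admissible Qc Mc Ω Ψb → Ψ' 0 =ᵐ[volume.restrict Ω] Ψ 0 →
      Ferronematic.IsIteration Qc Mc Ω Ψ n w → Ferronematic.IsIteration Qc Mc Ω Ψ' n' w' →
      ∀ j, n' j =ᵐ[volume.restrict Ω] n j ∧ w' j =ᵐ[volume.restrict Ω] w j ∧
        Ψ' j =ᵐ[volume.restrict Ω] Ψ j) ∧
    -- every sequence that it generates stays in `W` and has non-increasing energy
    (∀ (Ψ : ℕ → Ferronematic.Eucl 2 → Ferronematic.Eucl 4)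
      (n w : ℕ → Ferronematic.Eucl 2 → Ferronematic.Eucl 2),
      Ψ 0 ∈ Ferronematic.admissible Qc Mc Ω Ψb → Ferronematic.IsIteration Qc Mc Ω Ψ n w →
      (∀ j, Ferronematic.MemH1 Ω (n j) ∧
        (∀ᵐ x ∂(volume.restrict Ω), n j x ∈ Ferronematic.circleS) ∧
        (∀ᵐ x ∂(volume.restrict Ω), 1 ≤ ‖n j x - w j x‖)) ∧
      (∀ j, Ψ j ∈ Ferronematic.admissible Qc Mc Ω Ψb) ∧
      (∀ j, Ferronematic.energy Ω (Ψ (j + 1)) ≤ Ferronematic.energy Ω (Ψ j))) := by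
  have hO := hΩ.isOpen
  have hB := hΩ.isBounded
  refine ⟨fun Ψ₀ h0 => Ferronematic.exists_isIteration hO hB hMc hΨbN h0,
    fun Ψ Ψ' n w n' w' h0 h0' h h' => h.ae_eq hO hB hMc hΨbN h0 h0' h',
    fun Ψ n w h0 h => ?_⟩
  have hadm := h.mem_admissible hO hB hMc hΨbN h0
  have hstep := fun j => Ferronematic.iteration_step hO hB hMc hΨbN (hadm j) (h.pull_back j)
    (h.minimise j) (h.push_forward_eq j)
  refine ⟨fun j => ?_, hadm, fun j => (hstep j).2.2⟩
  obtain ⟨h1, h2, -⟩ :=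
    Ferronematic.admissible_pull_back hO hB hMc (hadm j) (h.pull_back j)
  exact ⟨h1, h2, (hstep j).1⟩
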